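/- **Theorem 1.** Write $\mathbb{R}_+=[0,\infty)$, $x^+=\max(x,0)$, and $|\cdot|$ for the Euclidean norm. Consider $$\dot y=f(y)+g(y)\big(u+\varphi'(y,w)\theta+A'(y,w)d\big),\qquad \dot w=h(y,w,\delta),$$ with $y\in\mathbb{R}^n$, $w\in\mathbb{R}^l$, $u\in\mathbb{R}$, $d\in\mathbb{R}^m$, $\theta\in\mathbb{R}^p$, $\delta\in\mathbb{R}^q$, where $f,g:\mathbb{R}^n\to\mathbb{R}^n$, $\varphi:\mathbb{R}^n\times\mathbb{R}^l\to\mathbb{R}^p$, $A:\mathbb{R}^n\times\mathbb{R}^l\to\mathbb{R}^m$, $h:\mathbb{R}^n\times\mathbb{R}^l\times\mathbb{R}^q\to\mathbb{R}^l$ are smooth and $f(0)=0$, $\varphi(0,0)=0$, $h(0,0,0)=0$. *Assumption (A).* There are smooth maps $V,Q:\mathbb{R}^n\to\mathbb{R}_+$, $k:\mathbb{R}^n\to\mathbb{R}$, $\Phi,R:\mathbb{R}^l\to\mathbb{R}_+$, $\mu:\mathbb{R}^n\to(0,\infty)$ with $k(0)=0$ and $V,Q,\Phi,R$ positive definite and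 radially unbounded (all sublevel sets compact), constants $r>0$, $\Lambda\ge 0$ and a non-decreasing continuous $\gamma:\mathbb{R}_+\to\mathbb{R}_+$ such that for all $y,w,\delta$ $$\nabla V(y)\big(f(y)+g(y)k(y)\big)\le -rQ(y),\qquad \nabla\Phi(w)h(y,w,\delta)\le -R(w)+\gamma(|\delta|)+Q(y),$$ $$|\varphi(y,w)-\varphi(y,0)|^2+|A(y,w)-A(y,0)|^2\le\mu(y)(R(w)+\Lambda),$$ $$|\varphi(y,0)|^2\le\mu(y)\big(Q(y)+\Lambda+(\nabla V(y)g(y))^2\big).$$ Suppose that (A) holds, and let $\varepsilon,\Gamma>0$, $a,\beta\in(0,1]$, $b,C\ge1$ with $2a\beta<br$. Apply the controller $$u=k(y)-C\mu^2(y)\tfrac{(b+e^z)^3}{a^3\beta^2}(\nabla V(y)g(y))^3-C\big(|A(y,0)|^2+|\varphi(y,0)|^2+\mu(y)+1\big)\tfrac{(b+e^z)^3}{a^3\beta^2}\nabla V(y)g(y),$$ $$\dot z=\Gamma e^{-z}(V(y)-\varepsilon)^+ ,\quad z\in\mathbb{R}.$$ Let $U(y,w)=V(y)+\frac r2\Phi(w)$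 and, for $s_1,\dots,s_4\ge0$, $$\chi(s_1,s_2,s_3,s_4)=\tfrac r2\gamma(s_2)+a\,\frac{s_1^2+s_1^4+\big((s_3-b-s_4)^+\big)^2+\big((s_3-b-s_4)^+\big)^4+2\beta\Lambda}{b+s_4}.$$ Then there exist $\omega\in KL$, $\zeta\in K_\infty$, a non-decreasing continuous $\tilde\zeta:\mathbb{R}_+\to\mathbb{R}_+$, with $\tilde\zeta(0)=0$ if $\gamma(0)=0$, and a continuous $B:\mathbb{R}^{n+l+1}\times\mathbb{R}^3\to\mathbb{R}$, such that for all $(y_0,w_0,z_0)\in\mathbb{R}^{n+l+1}$, $d\in L^\infty(\mathbb{R}_+;\mathbb{R}^m)$, $\theta\in L^\infty(\mathbb{R}_+;\mathbb{R}^p)$, $\delta\in L^\infty(\mathbb{R}_+;\mathbb{R}^q)$ the closed-loop system with $(y,w,z)(0)=(y_0,w_0,z_0)$ has a unique (Carathéodory) solution; it is defined for all $t\ge0$, $z$ is non-decreasing, $V(y(t))$ and $\Phi(w(t))$ are bounded, and $$\limsup_{t\to\infty}V(y(t))\le\varepsilon,\qquad \limsup_{t\to\infty}\Phi(w(t))\le\tilde\zeta\Big(\varepsilon+\limsup_{t\to\infty}|\delta(t)|\Big),$$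 $$U(y(t),w(t))\le\omega(U(y_0,w_0),t)+\zeta\big(\chi(\|d\|_\infty,\|\delta\|_\infty,\|\theta\|_\infty,e^{z_0})\big)\quad\text{for all }t\ge0,$$ $$z_0\le z(t)\le\lim_{s\to\infty}z(s)\le B(y_0,w_0,z_0,\|d\|_\infty,\|\delta\|_\infty,\|\theta\|_\infty)\quad\text{for all }t\ge0,$$ where the last limit exists and is finite. Moreover, if $\gamma(0)=\Lambda=0$, $\lim_{t\to\infty}d(t)=0$, $\lim_{t\to\infty}\delta(t)=0$ and $\theta$ is constant, then either $\lim_{t\to\infty}|y(t)|=\lim_{t\to\infty}|w(t)|=0$, or $|\theta|>b$ and $\lim_{s\to\infty}z(s)<\ln(|\theta|-b)$. Here $\|\cdot\|_\infty$ is the essential supremum norm, and limits superior, limits and constancy of the inputs $d,\theta,\delta$ are understood up to Lebesgue null sets. -/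

import Mathlib

open Set Filter Topology MeasureTheory
open scoped ContDiff

namespace DADS

/-- The space `ℝⁿ` with its Euclidean norm. -/
abbrev Vec (n : ℕ) : Type := EuclideanSpace ℝ (Fin n)

/-- Class `K`: (strictly) increasing continuous functions `ℝ₊ → ℝ₊` vanishing at `0`.
Only the values on `[0, ∞)` matter. -/
structure IsClassK (f : ℝ → ℝ) : Prop where
  continuousOn : ContinuousOn f (Ici 0)
  strictMonoOn : StrictMonoOn f (Ici 0)
  map_zero : f 0 = 0

/-- Class `K_∞`. -/
structure IsClassKInfty (f : ℝ → ℝ) : Prop where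
  isClassK : IsClassK f
  tendsto_atTop : Tendsto f atTop atTop

/-- Class `KL`. -/
structure IsClassKL (σ : ℝ → ℝ → ℝ) : Prop where
  continuousOn : ContinuousOn (fun x : ℝ × ℝ => σ x.1 x.2) (Ici 0 ×ˢ Ici 0)
  isClassK : ∀ t, 0 ≤ t → IsClassK (fun s => σ s t)
  antitoneOn : ∀ s, 0 ≤ s → AntitoneOn (fun t => σ s t) (Ici 0)
  tendsto_zero : ∀ s, 0 ≤ s → Tendsto (fun t => σ s t) atTop (𝓝 0)

/-- A non-decreasing function of class `C⁰(ℝ₊; ℝ₊)`. -/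
structure IsGainFunction (f : ℝ → ℝ) : Prop where
  continuousOn : ContinuousOn f (Ici 0)
  monotoneOn : MonotoneOn f (Ici 0)
  nonneg : ∀ s, 0 ≤ s → 0 ≤ f s

/-- Smooth, positive definite and radially unbounded. -/
structure IsSmoothProperPosDef {n : ℕ} (V : Vec n → ℝ) : Prop where
  smooth : ContDiff ℝ ∞ V
  map_zero : V 0 = 0
  pos : ∀ x, x ≠ 0 → 0 < V x
  radiallyUnbounded : ∀ M : ℝ, 0 < M → IsCompact {x | V x ≤ M}

/-- The plant
`ẏ = f(y) + g(y) (u + φ(y,w)ᵀ θ + A(y,w)ᵀ d)`, `ẇ = h(y,w,δ)`, with scalar input `u`. -/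
structure Plant (n l m p q : ℕ) where
  f : Vec n → Vec n
  g : Vec n → Vec n
  φ : Vec n → Vec l → Vec p
  A : Vec n → Vec l → Vec m
  h : Vec n → Vec l → Vec q → Vec l
  smooth_f : ContDiff ℝ ∞ f
  smooth_g : ContDiff ℝ ∞ g
  smooth_φ : ContDiff ℝ ∞ (fun x : Vec n × Vec l => φ x.1 x.2)
  smooth_A : ContDiff ℝ ∞ (fun x : Vec n × Vec l => A x.1 x.2)
  smooth_h : ContDiff ℝ ∞ (fun x : Vec n × Vec l × Vec q => h x.1 x.2.1 x.2.2)
  f_zero : f 0 = 0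
  φ_zero : φ 0 0 = 0
  h_zero : h 0 0 0 = 0

/-- The standing assumption on the plant: `V, Q, k, Φ, R, μ, r, Λ, γ` are as required.
Here `fderiv ℝ V y v` is `∇V(y) v`. -/
structure AssumptionA {n l m p q : ℕ} (S : Plant n l m p q)
    (V Q k : Vec n → ℝ) (Φ R : Vec l → ℝ) (μ : Vec n → ℝ)
    (r Λ : ℝ) (γ : ℝ → ℝ) : Prop where
  V_prop : IsSmoothProperPosDef V
  Q_prop : IsSmoothProperPosDef Q
  Φ_prop : IsSmoothProperPosDef Φ
  R_prop : IsSmoothProperPosDef R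
  k_smooth : ContDiff ℝ ∞ k
  k_zero : k 0 = 0
  μ_smooth : ContDiff ℝ ∞ μ
  μ_pos : ∀ y, 0 < μ y
  r_pos : 0 < r
  Λ_nonneg : 0 ≤ Λ
  γ_prop : IsGainFunction γ
  decrease_V : ∀ y, fderiv ℝ V y (S.f y + k y • S.g y) ≤ -r * Q y
  decrease_Φ : ∀ y w δ, fderiv ℝ Φ w (S.h y w δ) ≤ -R w + γ ‖δ‖ + Q y
  growth_w : ∀ y w, ‖S.φ y w - S.φ y 0‖ ^ 2 + ‖S.A y w - S.A y 0‖ ^ 2 ≤ μ y * (R w + Λ)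
  growth_y : ∀ y, ‖S.φ y 0‖ ^ 2 ≤ μ y * (Q y + Λ + (fderiv ℝ V y (S.g y)) ^ 2)

/-- The feedback law `u(y, z)`. -/
noncomputable def control {n l m p q : ℕ} (S : Plant n l m p q) (V k μ : Vec n → ℝ)
    (a β b C : ℝ) (y : Vec n) (z : ℝ) : ℝ :=
  k y
    - C * μ y ^ 2 * ((b + Real.exp z) ^ 3 / (a ^ 3 * β ^ 2)) * (fderiv ℝ V y (S.g y)) ^ 3
    - C * (‖S.A y 0‖ ^ 2 + ‖S.φ y 0‖ ^ 2 + μ y + 1)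
        * ((b + Real.exp z) ^ 3 / (a ^ 3 * β ^ 2)) * fderiv ℝ V y (S.g y)

/-- Right-hand side of the closed loop, with state `(y, w, z)`, for given inputs `d, θ, δ`. -/
noncomputable def closedLoop {n l m p q : ℕ} (S : Plant n l m p q) (V k μ : Vec n → ℝ)
    (ε Γ a β b C : ℝ) (d : ℝ → Vec m) (θ : ℝ → Vec p) (δ : ℝ → Vec q)
    (t : ℝ) (x : Vec n × Vec l × ℝ) : Vec n × Vec l × ℝ :=
  (S.f x.1 + (control S V k μ a β b C x.1 x.2.2
      + inner ℝ (S.φ x.1 x.2.1) (θ t) + inner ℝ (S.A x.1 x.2.1) (d t)) • S.g x.1,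
    S.h x.1 x.2.1 (δ t),
    Γ * Real.exp (-x.2.2) * max (V x.1 - ε) 0)

/-- Carathéodory solution of `ẋ = F(t, x)`, `x(0) = x₀` on an interval `I` with left endpoint
`0 ∈ I`: locally absolutely continuous and satisfying the equation almost everywhere, written
in the equivalent integrated form. -/
structure IsCaratheodorySolution {E : Type*} [NormedAddCommGroup E] [NormedSpace ℝ E]
    (F : ℝ → E → E) (x₀ : E) (I : Set ℝ) (x : ℝ → E) : Prop where
  continuousOn : ContinuousOn x I
  integrable : ∀ t ∈ I, IntervalIntegrable (fun s => F s (x s)) volume 0 t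
  eq_integral : ∀ t ∈ I, x t = x₀ + ∫ s in (0 : ℝ)..t, F s (x s)

/-- Membership in `L^∞(ℝ₊; ℝᵏ)`. -/
def IsLInfty {k : ℕ} (d : ℝ → Vec k) : Prop :=
  MemLp d ⊤ (volume.restrict (Ici (0 : ℝ)))

/-- The norm `‖d‖_∞` of `L^∞(ℝ₊; ℝᵏ)` (an essential supremum). -/
noncomputable def supNorm {k : ℕ} (d : ℝ → Vec k) : ℝ :=
  (eLpNorm d ⊤ (volume.restrict (Ici (0 : ℝ)))).toReal

/-- `t → +∞` up to Lebesgue null sets: a property holds eventually along this filter iff there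
is `T` such that it holds for almost every `t ≥ T`. -/
noncomputable def essAtTop : Filter ℝ := atTop ⊓ ae volume

/-- The function `χ`. -/
noncomputable def chi (γ : ℝ → ℝ) (r Λ a β b : ℝ) (s₁ s₂ s₃ s₄ : ℝ) : ℝ :=
  r / 2 * γ s₂
    + a * ((s₁ ^ 2 + s₁ ^ 4 + (max (s₃ - b - s₄) 0) ^ 2 + (max (s₃ - b - s₄) 0) ^ 4
        + 2 * β * Λ) / (b + s₄))

/-- The function `U(y, w) = V(y) + (r/2) Φ(w)`. -/
noncomputable def lyapU {n l : ℕ} (V : Vec n → ℝ) (Φ : Vec l → ℝ) (r : ℝ)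
    (y : Vec n) (w : Vec l) : ℝ :=
  V y + r / 2 * Φ w

end DADS

open scoped NNReal

/-!
The damping terms of the controller are chosen so that, along solutions, Young's inequality gives
`U' ≤ -rate * (Q + R) + χ` with a positive constant `rate`; comparison with a scalar equation then
yields the stability bound. The gain is bounded because of a second Lyapunov function. If `M` bounds
the perturbation terms and `P ≤ rate * Q` on `{V ≥ ε}`, then
`(V - ε)⁺ ^ 2 / 2 + (P / Γ) * e ^ z - (M / Γ) * log (b + e ^ z)` is non-increasing, since
`(e ^ z)' = Γ * (V - ε)⁺`, and it dominates a function of `z` that tends to infinity with `z`. Both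
this quantity and `z` converge, hence so does `(V - ε)⁺`, whose limit is `0` because otherwise
`e ^ z` would grow without bound. The bound on `Φ` then follows from its own dissipation inequality.
For vanishing inputs the term `χ` tends to `0` as soon as `|θ| - b ≤ e ^ z` in the limit, which
forces the state to `0`; this is the dichotomy of the last claim.
-/

namespace DADS

section Caratheodory

variable {E : Type*} [NormedAddCommGroup E]

/-- Carathéodory vector fields: measurable along continuous curves and, on each ball, bounded and
Lipschitz in the state with constants that do not depend on (almost every) time `t ≥ 0`. -/
structure IsCaratheodoryField (F : ℝ → E → E) : Prop where
  aestronglyMeasurable_comp : ∀ x : ℝ → E, Continuous x →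
    AEStronglyMeasurable (fun s => F s (x s)) (volume.restrict (Ici 0))
  exists_bound_lipschitz : ∀ ρ : ℝ, ∃ M L : ℝ≥0, ∀ᵐ t, 0 ≤ t →
    (∀ x ∈ Metric.closedBall (0 : E) ρ, ‖F t x‖ ≤ M) ∧
      LipschitzOnWith L (F t) (Metric.closedBall 0 ρ)

lemma isCaratheodoryField_of_locallyLipschitz {I : Type*} [NormedAddCommGroup I] [ProperSpace E]
    [ProperSpace I] {G : E × I → E} (hG : LocallyLipschitz G) {v : ℝ → I} {Mv : ℝ}
    (hv : AEStronglyMeasurable v (volume.restrict (Ici 0))) (hvb : ∀ᵐ t, 0 ≤ t → ‖v t‖ ≤ Mv) :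
    IsCaratheodoryField fun t x => G (x, v t) where
  aestronglyMeasurable_comp x hx :=
    hG.continuous.comp_aestronglyMeasurable (hx.aestronglyMeasurable.prodMk hv)
  exists_bound_lipschitz ρ := by
    have hK : IsCompact (Metric.closedBall (0 : E) ρ ×ˢ Metric.closedBall (0 : I) Mv) :=
      (isCompact_closedBall _ _).prod (isCompact_closedBall _ _)
    obtain ⟨M, hM⟩ := hK.exists_bound_of_continuousOn hG.continuous.continuousOn
    obtain ⟨L, hL⟩ := hG.locallyLipschitzOn.exists_lipschitzOnWith_of_compact hK
    refine ⟨M.toNNReal, L, ?_⟩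
    filter_upwards [hvb] with t ht ht0
    have hvt : v t ∈ Metric.closedBall (0 : I) Mv := mem_closedBall_zero_iff.2 (ht ht0)
    refine ⟨fun x hx => (hM (x, v t) ⟨hx, hvt⟩).trans (le_max_left M 0), ?_⟩
    simpa [Function.comp_def] using hL.comp (LipschitzWith.prodMk_right (v t)).lipschitzOnWith
      fun x hx => (⟨hx, hvt⟩ : (x, v t) ∈ Metric.closedBall (0 : E) ρ ×ˢ Metric.closedBall 0 Mv)

lemma IsCaratheodoryField.intervalIntegrable_comp {F : ℝ → E → E} (hF : IsCaratheodoryField F)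
    {x : ℝ → E} (hx : Continuous x) {t : ℝ} (ht : 0 ≤ t) :
    IntervalIntegrable (fun s => F s (x s)) volume 0 t := by
  obtain ⟨ρ, hρ⟩ := isCompact_Icc.exists_bound_of_continuousOn (hx.continuousOn (s := Icc 0 t))
  obtain ⟨M, _, hM⟩ := hF.exists_bound_lipschitz ρ
  rw [intervalIntegrable_iff_integrableOn_Ioc_of_le ht]
  refine Integrable.mono' (integrable_const (M : ℝ))
    ((hF.aestronglyMeasurable_comp x hx).mono_measure
      (Measure.restrict_mono (fun s hs => hs.1.le) le_rfl)) ?_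
  rw [ae_restrict_iff' measurableSet_Ioc]
  filter_upwards [hM] with s hs hst
  exact (hs hst.1.le).1 _ (mem_closedBall_zero_iff.2 (hρ s (Ioc_subset_Icc_self hst)))

variable [NormedSpace ℝ E]

lemma integral_exp_mul_le {lam t : ℝ} (hlam : 0 < lam) :
    ∫ s in (0 : ℝ)..t, Real.exp (lam * s) ≤ Real.exp (lam * t) / lam := by
  rw [intervalIntegral.integral_comp_mul_left _ hlam.ne', integral_exp, smul_eq_mul, mul_zero,
    Real.exp_zero, ← div_eq_inv_mul]
  gcongr
  linarith

lemma norm_integral_le_of_norm_le_exp {f : ℝ → E} {D lam t : ℝ} (hD : 0 ≤ D) (hlam : 0 < lam)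
    (ht : 0 ≤ t) (hf : ∀ᵐ s, s ∈ Ioc 0 t → ‖f s‖ ≤ D * Real.exp (lam * s)) :
    ‖∫ s in (0 : ℝ)..t, f s‖ ≤ D / lam * Real.exp (lam * t) := by
  calc ‖∫ s in (0 : ℝ)..t, f s‖
      ≤ ∫ s in (0 : ℝ)..t, D * Real.exp (lam * s) :=
        intervalIntegral.norm_integral_le_of_norm_le ht hf
          (Continuous.intervalIntegrable (by fun_prop) _ _)
    _ = D * ∫ s in (0 : ℝ)..t, Real.exp (lam * s) := intervalIntegral.integral_const_mul _ _
    _ ≤ D * (Real.exp (lam * t) / lam) := by gcongr; exact integral_exp_mul_le hlam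
    _ = D / lam * Real.exp (lam * t) := by ring

/-! ### Existence for globally Lipschitz fields -/

namespace IsCaratheodoryField

variable {F : ℝ → E → E}

lemma continuous_primitive (hF : IsCaratheodoryField F) {x : ℝ → E} (hx : Continuous x) :
    Continuous fun t : ℝ => ∫ s in (0 : ℝ)..max t 0, F s (x s) := by
  refine continuous_iff_continuousAt.2 fun t₀ => ?_
  set T := max t₀ 0 + 1
  have hT : 0 ≤ T := by positivity
  have hint := hF.intervalIntegrable_comp hx hT
  rw [intervalIntegrable_iff_integrableOn_Icc_of_le hT, ← uIcc_of_le hT] at hint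
  have hcont := intervalIntegral.continuousOn_primitive_interval hint
  rw [uIcc_of_le hT] at hcont
  have hmaps : ContinuousOn (fun t : ℝ => ∫ s in (0 : ℝ)..max t 0, F s (x s)) (Iic T) :=
    hcont.comp (by fun_prop) fun t ht => ⟨le_max_right _ _, max_le ht hT⟩
  exact hmaps.continuousAt (Iic_mem_nhds ((le_max_left t₀ 0).trans_lt (lt_add_one _)))

lemma norm_integral_sub_le (hF : IsCaratheodoryField F) {L : ℝ≥0}
    (hL : ∀ᵐ t, 0 ≤ t → LipschitzWith L (F t)) {x y : ℝ → E} (hx : Continuous x)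
    (hy : Continuous y) {D lam t : ℝ} (hD : 0 ≤ D) (hlam : 0 < lam) (ht : 0 ≤ t)
    (hxy : ∀ s, 0 ≤ s → ‖x s - y s‖ ≤ D * Real.exp (lam * s)) :
    ‖(∫ s in (0 : ℝ)..t, F s (x s)) - ∫ s in (0 : ℝ)..t, F s (y s)‖
      ≤ L * D / lam * Real.exp (lam * t) := by
  rw [← intervalIntegral.integral_sub (hF.intervalIntegrable_comp hx ht)
    (hF.intervalIntegrable_comp hy ht)]
  refine norm_integral_le_of_norm_le_exp (by positivity) hlam ht ?_
  filter_upwards [hL] with s hs hst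
  calc ‖F s (x s) - F s (y s)‖ ≤ L * ‖x s - y s‖ := (hs hst.1.le).norm_sub_le _ _
    _ ≤ L * (D * Real.exp (lam * s)) := by gcongr; exact hxy s hst.1.le
    _ = L * D * Real.exp (lam * s) := by ring

/-- The curve `t ↦ e^{λ t} u(t)`, constant for `t ≤ 0`. Measuring curves by the sup norm of `u`
(Bielecki's weighted norm) turns Picard's map into a contraction on all of `[0, ∞)` at once. -/
noncomputable def unweight (lam : ℝ) (u : ℝ → E) (t : ℝ) : E :=
  Real.exp (lam * max t 0) • u (max t 0)

/-- Picard's map `x ↦ x₀ + ∫₀ᵗ F(s, x(s)) ds` read off in terms of the weighted curve `u`. -/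
noncomputable def picardMap (F : ℝ → E → E) (x₀ : E) (lam : ℝ) (u : ℝ → E) (t : ℝ) : E :=
  Real.exp (-(lam * max t 0)) • (x₀ + ∫ s in (0 : ℝ)..max t 0, F s (unweight lam u s))

lemma continuous_unweight {lam : ℝ} {u : ℝ → E} (hu : Continuous u) :
    Continuous (unweight lam u) := by
  unfold unweight
  fun_prop

lemma continuous_picardMap (hF : IsCaratheodoryField F) (x₀ : E) {lam : ℝ} {u : ℝ → E}
    (hu : Continuous u) : Continuous (picardMap F x₀ lam u) :=
  (by fun_prop : Continuous fun t : ℝ => Real.exp (-(lam * max t 0))).smul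
    (continuous_const.add (hF.continuous_primitive (continuous_unweight hu)))

lemma norm_unweight_sub_le {lam D : ℝ} {u w : ℝ → E} (huw : ∀ s, ‖u s - w s‖ ≤ D) {s : ℝ}
    (hs : 0 ≤ s) : ‖unweight lam u s - unweight lam w s‖ ≤ D * Real.exp (lam * s) := by
  rw [unweight, unweight, max_eq_left hs, ← smul_sub, norm_smul,
    Real.norm_of_nonneg (by positivity), mul_comm]
  gcongr
  exact huw s

lemma norm_picardMap_sub_le (hF : IsCaratheodoryField F) {L : ℝ≥0}
    (hL : ∀ᵐ t, 0 ≤ t → LipschitzWith L (F t)) (x₀ : E) {lam D : ℝ} (hlam : 0 < lam)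
    (hLlam : 2 * L ≤ lam) {u w : ℝ → E} (hu : Continuous u) (hw : Continuous w)
    (huw : ∀ s, ‖u s - w s‖ ≤ D) (t : ℝ) :
    ‖picardMap F x₀ lam u t - picardMap F x₀ lam w t‖ ≤ 1 / 2 * D := by
  have hD : 0 ≤ D := (norm_nonneg _).trans (huw 0)
  have hexp : Real.exp (-(lam * max t 0)) * Real.exp (lam * max t 0) = 1 := by
    rw [← Real.exp_add, neg_add_cancel, Real.exp_zero]
  rw [picardMap, picardMap, ← smul_sub, add_sub_add_left_eq_sub, norm_smul,
    Real.norm_of_nonneg (by positivity)]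
  calc _ ≤ Real.exp (-(lam * max t 0)) * (L * D / lam * Real.exp (lam * max t 0)) := by
        gcongr
        exact hF.norm_integral_sub_le hL (continuous_unweight hu) (continuous_unweight hw) hD hlam
          (le_max_right _ _) fun s => norm_unweight_sub_le huw
    _ = L * D / lam := by linear_combination L * D / lam * hexp
    _ ≤ 1 / 2 * D := by
        rw [div_le_iff₀ hlam]
        nlinarith

lemma norm_picardMap_zero_le (hF : IsCaratheodoryField F) (x₀ : E) {lam : ℝ} (hlam : 0 < lam) :
    ∃ M : ℝ, ∀ t, ‖picardMap F x₀ lam 0 t‖ ≤ M := by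
  obtain ⟨M, _, hM⟩ := hF.exists_bound_lipschitz 0
  refine ⟨‖x₀‖ + M / lam, fun t => ?_⟩
  have hint : ‖∫ s in (0 : ℝ)..max t 0, F s (unweight lam 0 s)‖
      ≤ M / lam * Real.exp (lam * max t 0) := by
    refine norm_integral_le_of_norm_le_exp M.2 hlam (le_max_right _ _) ?_
    filter_upwards [hM] with s hs hst
    have hexp : 1 ≤ Real.exp (lam * s) := Real.one_le_exp (mul_nonneg hlam.le hst.1.le)
    exact ((hs hst.1.le).1 _ (by simp [unweight])).trans (le_mul_of_one_le_right M.2 hexp)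
  have hexp : Real.exp (-(lam * max t 0)) ≤ 1 :=
    Real.exp_le_one_iff.2 (neg_nonpos.2 (mul_nonneg hlam.le (le_max_right _ _)))
  rw [picardMap, norm_smul, Real.norm_of_nonneg (by positivity)]
  calc _ ≤ Real.exp (-(lam * max t 0)) * (‖x₀‖ + M / lam * Real.exp (lam * max t 0)) := by
        gcongr
        exact norm_add_le_of_le le_rfl hint
    _ = Real.exp (-(lam * max t 0)) * ‖x₀‖ + M / lam := by
        rw [mul_add, mul_left_comm, ← Real.exp_add, neg_add_cancel, Real.exp_zero, mul_one]
    _ ≤ ‖x₀‖ + M / lam := by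
        gcongr
        exact mul_le_of_le_one_left (norm_nonneg _) hexp

open BoundedContinuousFunction in
lemma exists_fixedPoint_picardMap [CompleteSpace E] (hF : IsCaratheodoryField F) {L : ℝ≥0}
    (hL : ∀ᵐ t, 0 ≤ t → LipschitzWith L (F t)) (x₀ : E) {lam : ℝ} (hlam : 0 < lam)
    (hLlam : 2 * L ≤ lam) : ∃ u : ℝ → E, Continuous u ∧ picardMap F x₀ lam u = u := by
  obtain ⟨M, hM⟩ := hF.norm_picardMap_zero_le x₀ hlam
  have hbound : ∀ (u : ℝ →ᵇ E) (t : ℝ), ‖picardMap F x₀ lam u t‖ ≤ 1 / 2 * ‖u‖ + M := by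
    intro u t
    have hsub := hF.norm_picardMap_sub_le hL x₀ hlam hLlam u.continuous continuous_zero
      (fun s => by simpa using u.norm_coe_le_norm s) t
    calc _ = ‖picardMap F x₀ lam u t - picardMap F x₀ lam 0 t + picardMap F x₀ lam 0 t‖ := by
          rw [sub_add_cancel]
      _ ≤ _ := norm_add_le_of_le hsub (hM t)
  let T : (ℝ →ᵇ E) → (ℝ →ᵇ E) := fun u =>
    .ofNormedAddCommGroup _ (hF.continuous_picardMap x₀ u.continuous) _ (hbound u)
  have hT : ContractingWith (1 / 2) T := by
    refine ⟨by rw [← NNReal.coe_lt_coe]; norm_num, LipschitzWith.of_dist_le_mul fun u w => ?_⟩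
    rw [dist_le (by positivity)]
    intro t
    have hdist : ∀ s, ‖u s - w s‖ ≤ dist u w := fun s => by
      simpa [dist_eq_norm] using dist_coe_le_dist (f := u) (g := w) s
    simpa [T, dist_eq_norm] using
      hF.norm_picardMap_sub_le hL x₀ hlam hLlam u.continuous w.continuous hdist t
  let u : ℝ →ᵇ E := ContractingWith.fixedPoint T hT
  have hfix : T u = u := hT.fixedPoint_isFixedPt
  exact ⟨u, u.continuous, congrArg DFunLike.coe hfix⟩

lemma exists_solution_of_lipschitzWith [CompleteSpace E] (hF : IsCaratheodoryField F) {L : ℝ≥0}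
    (hL : ∀ᵐ t, 0 ≤ t → LipschitzWith L (F t)) (x₀ : E) :
    ∃ x : ℝ → E, Continuous x ∧ IsCaratheodorySolution F x₀ (Ici 0) x := by
  obtain ⟨u, hu, hfix⟩ := hF.exists_fixedPoint_picardMap hL x₀ (lam := 2 * L + 1) (by positivity)
    (by linarith)
  have hcont : Continuous (unweight (2 * L + 1) u) := continuous_unweight hu
  refine ⟨unweight (2 * L + 1) u, hcont, hcont.continuousOn,
    fun t ht => hF.intervalIntegrable_comp hcont ht, fun t ht => ?_⟩
  rw [unweight, max_eq_left (mem_Ici.1 ht), ← hfix, picardMap, max_eq_left (mem_Ici.1 ht),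
    smul_smul, ← Real.exp_add, add_neg_cancel, Real.exp_zero, one_smul, hfix]

end IsCaratheodoryField

/-! ### Uniqueness and existence from a priori bounds -/

variable {F : ℝ → E → E} {x₀ : E}

namespace IsCaratheodorySolution

lemma mono {x : ℝ → E} {s t : Set ℝ} (h : IsCaratheodorySolution F x₀ t x) (hst : s ⊆ t) :
    IsCaratheodorySolution F x₀ s x :=
  ⟨h.continuousOn.mono hst, fun u hu => h.integrable u (hst hu),
    fun u hu => h.eq_integral u (hst hu)⟩

lemma apply_zero {x : ℝ → E} {s : Set ℝ} (h : IsCaratheodorySolution F x₀ s x) (hs : 0 ∈ s) :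
    x 0 = x₀ := by
  simpa using h.eq_integral 0 hs

lemma eqOn_Icc (hF : IsCaratheodoryField F) {T : ℝ} {x y : ℝ → E}
    (hx : IsCaratheodorySolution F x₀ (Icc 0 T) x)
    (hy : IsCaratheodorySolution F x₀ (Icc 0 T) y) : EqOn x y (Icc 0 T) := by
  rcases (Icc 0 T).eq_empty_or_nonempty with hT | hT
  · simp [hT]
  obtain ⟨ρ₁, hρ₁⟩ := isCompact_Icc.exists_bound_of_continuousOn hx.continuousOn
  obtain ⟨ρ₂, hρ₂⟩ := isCompact_Icc.exists_bound_of_continuousOn hy.continuousOn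
  obtain ⟨_, L, hL⟩ := hF.exists_bound_lipschitz (max ρ₁ ρ₂)
  set lam : ℝ := 2 * L + 1
  have hlam : 0 < lam := by positivity
  -- The weighted distance `e^{-λ t} ‖x - y‖` is at most half of its own maximum.
  obtain ⟨τ, hτ, hmax⟩ := isCompact_Icc.exists_isMaxOn hT
    (f := fun t => Real.exp (-(lam * t)) * ‖x t - y t‖)
    ((by fun_prop : Continuous fun t : ℝ => Real.exp (-(lam * t))).continuousOn.mul
      (hx.continuousOn.sub hy.continuousOn).norm)
  set D := Real.exp (-(lam * τ)) * ‖x τ - y τ‖ with hDdef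
  have hD : 0 ≤ D := by positivity
  have hle : ∀ t ∈ Icc 0 T, ‖x t - y t‖ ≤ D * Real.exp (lam * t) := fun t ht => by
    rw [mul_comm, ← div_le_iff₀' (Real.exp_pos _), div_eq_inv_mul, ← Real.exp_neg]
    exact hmax ht
  have hint : ‖x τ - y τ‖ ≤ L * D / lam * Real.exp (lam * τ) := by
    rw [hx.eq_integral τ hτ, hy.eq_integral τ hτ, add_sub_add_left_eq_sub,
      ← intervalIntegral.integral_sub (hx.integrable τ hτ) (hy.integrable τ hτ)]
    refine norm_integral_le_of_norm_le_exp (by positivity) hlam hτ.1 ?_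
    filter_upwards [hL] with s hs hsτ
    have hsT : s ∈ Icc 0 T := ⟨hsτ.1.le, hsτ.2.trans hτ.2⟩
    calc ‖F s (x s) - F s (y s)‖ ≤ L * ‖x s - y s‖ :=
          (hs hsτ.1.le).2.norm_sub_le
            (mem_closedBall_zero_iff.2 ((hρ₁ s hsT).trans (le_max_left _ _)))
            (mem_closedBall_zero_iff.2 ((hρ₂ s hsT).trans (le_max_right _ _)))
      _ ≤ L * (D * Real.exp (lam * s)) := by gcongr; exact hle s hsT
      _ = L * D * Real.exp (lam * s) := by ring
  have hD0 : D ≤ L * D / lam := by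
    refine le_of_mul_le_mul_right (le_of_eq_of_le ?_ hint) (Real.exp_pos (lam * τ))
    rw [hDdef, mul_right_comm, ← Real.exp_add, neg_add_cancel, Real.exp_zero, one_mul]
  rw [le_div_iff₀ hlam] at hD0
  have hD1 : D = 0 := by nlinarith [mul_nonneg hD L.2]
  intro t ht
  exact sub_eq_zero.1 (norm_le_zero_iff.1 ((hle t ht).trans_eq (by rw [hD1, zero_mul])))

lemma congr_field {F' : ℝ → E → E} {x : ℝ → E} {T : ℝ}
    (h : IsCaratheodorySolution F x₀ (Icc 0 T) x)
    (hFF' : ∀ s ∈ Ioo 0 T, F s (x s) = F' s (x s)) :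
    IsCaratheodorySolution F' x₀ (Icc 0 T) x := by
  have hcongr : ∀ t ∈ Icc 0 T, EqOn (fun s => F s (x s)) (fun s => F' s (x s)) (uIoo 0 t) :=
    fun t ht s hs => by
      rw [uIoo_of_le ht.1] at hs
      exact hFF' s ⟨hs.1, hs.2.trans_le ht.2⟩
  exact ⟨h.continuousOn, fun t ht => (h.integrable t ht).congr_uIoo (hcongr t ht),
    fun t ht => (h.eq_integral t ht).trans
      (by rw [intervalIntegral.integral_congr_uIoo (hcongr t ht)])⟩

end IsCaratheodorySolution

lemma isCaratheodorySolution_Icc_self (F : ℝ → E → E) (x₀ : E) :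
    IsCaratheodorySolution F x₀ (Icc 0 0) fun _ => x₀ where
  continuousOn := continuousOn_const
  integrable t ht := by
    rw [Icc_self, mem_singleton_iff] at ht
    simp [ht]
  eq_integral t ht := by
    rw [Icc_self, mem_singleton_iff] at ht
    simp [ht]

/-- The radial retraction onto the closed ball of radius `ρ`, by which a locally Lipschitz field
is made globally Lipschitz without changing it on the ball. -/
noncomputable def radialRetraction (ρ : ℝ) (x : E) : E := (ρ / max ρ ‖x‖) • x

lemma radialRetraction_of_norm_le {ρ : ℝ} (hρ : 0 < ρ) {x : E} (hx : ‖x‖ ≤ ρ) :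
    radialRetraction ρ x = x := by
  rw [radialRetraction, max_eq_left hx, div_self hρ.ne', one_smul]

lemma norm_radialRetraction_le {ρ : ℝ} (hρ : 0 < ρ) (x : E) : ‖radialRetraction ρ x‖ ≤ ρ := by
  have hm : 0 < max ρ ‖x‖ := lt_max_of_lt_left hρ
  rw [radialRetraction, norm_smul, Real.norm_of_nonneg (by positivity), div_mul_eq_mul_div,
    div_le_iff₀ hm]
  gcongr
  exact le_max_right _ _

lemma lipschitzWith_radialRetraction {ρ : ℝ} (hρ : 0 < ρ) :
    LipschitzWith 2 (radialRetraction ρ : E → E) := by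
  refine LipschitzWith.of_dist_le_mul fun x y => ?_
  rw [dist_eq_norm, dist_eq_norm, NNReal.coe_ofNat]
  set a := max ρ ‖x‖
  set b := max ρ ‖y‖
  have ha : 0 < a := lt_max_of_lt_left hρ
  have hb : 0 < b := lt_max_of_lt_left hρ
  have hρa : ρ / a ≤ 1 := (div_le_one ha).2 (le_max_left _ _)
  have hyb : ‖y‖ / b ≤ 1 := (div_le_one hb).2 (le_max_right _ _)
  have hab : |b - a| ≤ ‖x - y‖ := by
    calc |b - a| ≤ |‖y‖ - ‖x‖| := by
          simpa only [a, b, max_comm ρ] using abs_max_sub_max_le_abs ‖y‖ ‖x‖ ρ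
      _ ≤ ‖x - y‖ := by rw [norm_sub_rev]; exact abs_norm_sub_norm_le y x
  have hsplit : radialRetraction ρ x - radialRetraction ρ y
      = (ρ / a) • ((x - y) + ((b - a) / b) • y) := by
    rw [radialRetraction, radialRetraction, smul_add, smul_sub, smul_smul, sub_add,
      ← sub_smul]
    congr 2
    field_simp
    ring
  calc ‖radialRetraction ρ x - radialRetraction ρ y‖
      = ρ / a * ‖(x - y) + ((b - a) / b) • y‖ := by
        rw [hsplit, norm_smul, Real.norm_of_nonneg (by positivity)]
    _ ≤ 1 * (‖x - y‖ + |b - a| * (‖y‖ / b)) := by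
        gcongr
        refine norm_add_le_of_le le_rfl (le_of_eq ?_)
        rw [norm_smul, Real.norm_eq_abs, abs_div, abs_of_pos hb]
        ring
    _ ≤ 1 * (‖x - y‖ + ‖x - y‖ * 1) := by gcongr
    _ = 2 * ‖x - y‖ := by ring

lemma IsCaratheodoryField.comp_radialRetraction (hF : IsCaratheodoryField F) {ρ : ℝ}
    (hρ : 0 < ρ) : IsCaratheodoryField fun t x => F t (radialRetraction ρ x) where
  aestronglyMeasurable_comp x hx := hF.aestronglyMeasurable_comp _
    ((lipschitzWith_radialRetraction hρ).continuous.comp hx)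
  exists_bound_lipschitz ρ' := by
    obtain ⟨M, L, h⟩ := hF.exists_bound_lipschitz ρ
    have hmaps : ∀ x : E, radialRetraction ρ x ∈ Metric.closedBall 0 ρ := fun x =>
      mem_closedBall_zero_iff.2 (norm_radialRetraction_le hρ x)
    refine ⟨M, L * 2, ?_⟩
    filter_upwards [h] with t ht ht0
    exact ⟨fun x _ => (ht ht0).1 _ (hmaps x),
      (ht ht0).2.comp (lipschitzWith_radialRetraction hρ).lipschitzOnWith fun x _ => hmaps x⟩

lemma IsCaratheodoryField.lipschitzWith_comp_radialRetraction (hF : IsCaratheodoryField F) {ρ : ℝ}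
    (hρ : 0 < ρ) :
    ∃ L : ℝ≥0, ∀ᵐ t, 0 ≤ t → LipschitzWith L fun x => F t (radialRetraction ρ x) := by
  obtain ⟨_, L, h⟩ := hF.exists_bound_lipschitz ρ
  refine ⟨L * 2, ?_⟩
  filter_upwards [h] with t ht ht0
  rw [← lipschitzOnWith_univ]
  exact (ht ht0).2.comp (lipschitzWith_radialRetraction hρ).lipschitzOnWith fun x _ =>
    mem_closedBall_zero_iff.2 (norm_radialRetraction_le hρ x)

lemma forall_lt_of_forall_Ico_lt {f : ℝ → ℝ} {ρ : ℝ} (hf : ContinuousOn f (Ici 0))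
    (h : ∀ T, 0 ≤ T → (∀ s ∈ Ico 0 T, f s < ρ) → f T < ρ) : ∀ t, 0 ≤ t → f t < ρ := by
  by_contra! hcon
  set S := {t : ℝ | 0 ≤ t ∧ ρ ≤ f t}
  have hSb : BddBelow S := ⟨0, fun t ht => ht.1⟩
  have hSc : IsClosed S := hf.preimage_isClosed_of_isClosed isClosed_Ici isClosed_Ici
  obtain ⟨h0, hρ⟩ := hSc.csInf_mem hcon hSb
  refine hρ.not_gt (h _ h0 fun s hs => ?_)
  by_contra! hle
  exact hs.2.not_ge (csInf_le hSb ⟨hs.1, hle⟩)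

lemma IsCaratheodoryField.exists_solution_of_apriori_bound [CompleteSpace E]
    (hF : IsCaratheodoryField F) {ρ : ℝ}
    (hρ : ∀ T x, 0 ≤ T → IsCaratheodorySolution F x₀ (Icc 0 T) x → ‖x T‖ < ρ) :
    ∃ x : ℝ → E, IsCaratheodorySolution F x₀ (Ici 0) x := by
  have hρ0 : 0 < ρ := (norm_nonneg _).trans_lt
    (hρ 0 _ le_rfl (isCaratheodorySolution_Icc_self F x₀))
  obtain ⟨L, hL⟩ := hF.lipschitzWith_comp_radialRetraction hρ0
  obtain ⟨x, hxc, hx⟩ :=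
    (hF.comp_radialRetraction hρ0).exists_solution_of_lipschitzWith hL x₀
  have hsol : ∀ T, (∀ s ∈ Ico 0 T, ‖x s‖ < ρ) → IsCaratheodorySolution F x₀ (Icc 0 T) x :=
    fun T hT => (hx.mono Icc_subset_Ici_self).congr_field fun s hs => by
      rw [radialRetraction_of_norm_le hρ0 (hT s (Ioo_subset_Ico_self hs)).le]
  have hlt : ∀ t, 0 ≤ t → ‖x t‖ < ρ :=
    forall_lt_of_forall_Ico_lt hxc.norm.continuousOn fun T hT h => hρ T x hT (hsol T h)
  have hsol' : ∀ T, IsCaratheodorySolution F x₀ (Icc 0 T) x := fun T =>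
    hsol T fun s hs => hlt s hs.1
  exact ⟨x, hxc.continuousOn, fun t ht => (hsol' t).integrable t ⟨ht, le_rfl⟩,
    fun t ht => (hsol' t).eq_integral t ⟨ht, le_rfl⟩⟩

/-! ### Differential inequalities -/

/-- The differential inequality `v' ≤ g` on `[a, b]` in Carathéodory's sense. -/
structure HasDerivLEOn (v g : ℝ → ℝ) (a b : ℝ) : Prop where
  absolutelyContinuousOn : AbsolutelyContinuousOnInterval v a b
  deriv_le : ∀ᵐ s, s ∈ Ioo a b → deriv v s ≤ g s

namespace IsCaratheodorySolution

lemma exists_lipschitzOnWith (hF : IsCaratheodoryField F) {T : ℝ} {x : ℝ → E}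
    (hx : IsCaratheodorySolution F x₀ (Icc 0 T) x) :
    ∃ M : ℝ≥0, LipschitzOnWith M x (Icc 0 T) := by
  obtain ⟨ρ, hρ⟩ := isCompact_Icc.exists_bound_of_continuousOn hx.continuousOn
  obtain ⟨M, _, hM⟩ := hF.exists_bound_lipschitz ρ
  refine ⟨M, LipschitzOnWith.of_dist_le_mul fun s hs t ht => ?_⟩
  rw [dist_eq_norm, hx.eq_integral s hs, hx.eq_integral t ht, add_sub_add_left_eq_sub,
    intervalIntegral.integral_interval_sub_left (hx.integrable s hs) (hx.integrable t ht),
    Real.dist_eq]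
  refine intervalIntegral.norm_integral_le_of_norm_le_const_ae ?_
  filter_upwards [hM] with r hr hrI
  have hrT : r ∈ Icc 0 T := uIcc_subset_Icc ht hs (uIoc_subset_uIcc hrI)
  exact (hr hrT.1).1 _ (mem_closedBall_zero_iff.2 (hρ r hrT))

lemma ae_hasDerivAt [CompleteSpace E] {T : ℝ} {x : ℝ → E}
    (hx : IsCaratheodorySolution F x₀ (Icc 0 T) x) :
    ∀ᵐ s, s ∈ Ioo 0 T → HasDerivAt x (F s (x s)) s := by
  rcases lt_or_ge T 0 with hT | hT
  · simp [Ioo_eq_empty_of_le hT.le]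
  filter_upwards [(hx.integrable T ⟨hT, le_rfl⟩).ae_hasDerivAt_integral] with s hs hsT
  have hint := (hs (by rw [uIcc_of_le hT]; exact Ioo_subset_Icc_self hsT) 0
    left_mem_uIcc).const_add x₀
  refine hint.congr_of_eventuallyEq ?_
  filter_upwards [Icc_mem_nhds hsT.1 hsT.2] with r hr using hx.eq_integral r hr

lemma hasDerivLEOn_comp [CompleteSpace E] (hF : IsCaratheodoryField F) {T : ℝ} (hT : 0 ≤ T)
    {x : ℝ → E} (hx : IsCaratheodorySolution F x₀ (Icc 0 T) x) {W : E → ℝ}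
    (hW : LocallyLipschitz W) {g : ℝ → ℝ}
    (h : ∀ᵐ s, s ∈ Ioo 0 T → HasDerivAt x (F s (x s)) s → deriv (fun t => W (x t)) s ≤ g s) :
    HasDerivLEOn (fun t => W (x t)) g 0 T := by
  obtain ⟨M, hM⟩ := hx.exists_lipschitzOnWith hF
  obtain ⟨K, hK⟩ := hW.locallyLipschitzOn.exists_lipschitzOnWith_of_compact
    (isCompact_Icc.image_of_continuousOn hx.continuousOn)
  refine ⟨?_, ?_⟩
  · have hWx := hK.comp hM (mapsTo_image x (Icc 0 T))
    rw [← uIcc_of_le hT] at hWx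
    exact hWx.absolutelyContinuousOnInterval
  · filter_upwards [h, hx.ae_hasDerivAt] with s hs hxs hsT using hs hsT (hxs hsT)

end IsCaratheodorySolution

end Caratheodory

lemma hasDerivAt_fst {E F : Type*} [NormedAddCommGroup E] [NormedSpace ℝ E] [NormedAddCommGroup F]
    [NormedSpace ℝ F] {x : ℝ → E × F} {v : E × F} {s : ℝ} (h : HasDerivAt x v s) :
    HasDerivAt (fun t => (x t).1) v.1 s :=
  (hasFDerivAt_fst (𝕜 := ℝ) (p := x s)).comp_hasDerivAt s h

lemma hasDerivAt_snd {E F : Type*} [NormedAddCommGroup E] [NormedSpace ℝ E] [NormedAddCommGroup F]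
    [NormedSpace ℝ F] {x : ℝ → E × F} {v : E × F} {s : ℝ} (h : HasDerivAt x v s) :
    HasDerivAt (fun t => (x t).2) v.2 s :=
  (hasFDerivAt_snd (𝕜 := ℝ) (p := x s)).comp_hasDerivAt s h

lemma hasDerivAt_max_sq_div_two (v : ℝ) :
    HasDerivAt (fun v : ℝ => max v 0 ^ 2 / 2) (max v 0) v := by
  have hbound : ∀ u : ℝ, |max u 0 ^ 2 / 2 - max v 0 ^ 2 / 2 - (u - v) * max v 0| ≤ (u - v) ^ 2 := by
    intro u
    rw [abs_le]
    rcases max_cases u 0 with ⟨hu, hu'⟩ | ⟨hu, hu'⟩ <;>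
    rcases max_cases v 0 with ⟨hv, hv'⟩ | ⟨hv, hv'⟩ <;>
    rw [hu, hv] <;> constructor <;> nlinarith [sq_nonneg (u - v)]
  rw [hasDerivAt_iff_isLittleO]
  refine (Asymptotics.IsBigO.of_bound 1 (.of_forall fun u => ?_)).trans_isLittleO
    (Asymptotics.isLittleO_pow_sub_sub v one_lt_two)
  simpa only [smul_eq_mul, Real.norm_eq_abs, abs_pow, sq_abs, one_mul] using hbound u

namespace HasDerivLEOn

variable {v g : ℝ → ℝ} {a b c l : ℝ}

lemma continuousOn (h : HasDerivLEOn v g a b) (hab : a ≤ b) : ContinuousOn v (Icc a b) := by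
  simpa only [uIcc_of_le hab] using h.absolutelyContinuousOn.continuousOn

lemma mono (h : HasDerivLEOn v g a b) {a' b' : ℝ} (ha : a ≤ a') (hab : a' ≤ b') (hb : b' ≤ b) :
    HasDerivLEOn v g a' b' where
  absolutelyContinuousOn := h.absolutelyContinuousOn.mono (by
    rw [uIcc_of_le hab, uIcc_of_le (ha.trans (hab.trans hb))]
    exact Icc_subset_Icc ha hb)
  deriv_le := h.deriv_le.mono fun _ hs hsI => hs (Ioo_subset_Ioo ha hb hsI)

lemma sub_le (h : HasDerivLEOn v g a b) (hab : a ≤ b) (hg : ∀ᵐ s, s ∈ Ioo a b → g s ≤ c) :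
    v b - v a ≤ c * (b - a) := by
  rw [← h.absolutelyContinuousOn.integral_deriv_eq_sub]
  calc ∫ s in a..b, deriv v s ≤ ∫ _ in a..b, c := by
        refine intervalIntegral.integral_mono_ae_restrict hab
          h.absolutelyContinuousOn.intervalIntegrable_deriv intervalIntegrable_const ?_
        rw [EventuallyLE, ← restrict_Ioo_eq_restrict_Icc, ae_restrict_iff' measurableSet_Ioo]
        filter_upwards [h.deriv_le, hg] with s hs hgs hsI using (hs hsI).trans (hgs hsI)
    _ = c * (b - a) := by rw [intervalIntegral.integral_const, smul_eq_mul, mul_comm]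

lemma antitoneOn (h : HasDerivLEOn v g a b) (hg : ∀ᵐ s, s ∈ Ioo a b → g s ≤ 0) :
    AntitoneOn v (Icc a b) := by
  intro s hs t ht hst
  have hsub := (h.mono hs.1 hst ht.2).sub_le hst
    (hg.mono fun r hr hrI => hr (Ioo_subset_Ioo hs.1 ht.2 hrI))
  linarith

lemma le_of_le (h : HasDerivLEOn v g a b) (hab : a ≤ b)
    (hg : ∀ᵐ s, s ∈ Ioo a b → l < v s → g s ≤ 0) (hl : v a ≤ l) : v b ≤ l := by
  set S := Icc a b ∩ v ⁻¹' Iic l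
  have hSc : IsClosed S := (h.continuousOn hab).preimage_isClosed_of_isClosed isClosed_Icc
    isClosed_Iic
  have hSb : BddAbove S := ⟨b, fun s hs => hs.1.2⟩
  -- After the last time `τ` at which `v ≤ l`, the function `v` does not increase.
  obtain ⟨⟨haτ, hτb⟩, hτl⟩ := hSc.csSup_mem ⟨a, ⟨⟨le_rfl, hab⟩, hl⟩⟩ hSb
  set τ := sSup S
  have hafter : ∀ s ∈ Ioc τ b, l < v s := fun s hs => by
    by_contra! hle
    exact hs.1.not_ge (le_csSup hSb ⟨⟨haτ.trans hs.1.le, hs.2⟩, hle⟩)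
  have hsub := (h.mono haτ hτb le_rfl).sub_le hτb (c := 0) (hg.mono fun s hs hsI =>
    hs ⟨haτ.trans_lt hsI.1, hsI.2⟩ (hafter s ⟨hsI.1, hsI.2.le⟩))
  have hτl' : v τ ≤ l := hτl
  linarith

lemma decay_of_lt (h : HasDerivLEOn v g a b) (hab : a ≤ b) {α : ℝ → ℝ} (hα : Monotone α)
    (hαl : 0 ≤ α l) (hg : ∀ᵐ s, s ∈ Ioo a b → l < v s → g s ≤ -α (v s)) (hl : l < v b) :
    α (v b) * (b - a) + v b ≤ v a := by
  have hg0 : ∀ᵐ s, s ∈ Ioo a b → l < v s → g s ≤ 0 := hg.mono fun s hs hsI hls =>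
    (hs hsI hls).trans (neg_nonpos.2 (hαl.trans (hα hls.le)))
  have habove : ∀ s ∈ Icc a b, l < v s := fun s hs => by
    by_contra! hle
    exact hl.not_ge ((h.mono hs.1 hs.2 le_rfl).le_of_le hs.2
      (hg0.mono fun r hr hrI => hr ⟨hs.1.trans_lt hrI.1, hrI.2⟩) hle)
  have hanti : AntitoneOn v (Icc a b) := h.antitoneOn
    (hg0.mono fun s hs hsI => hs hsI (habove s (Ioo_subset_Icc_self hsI)))
  have hsub := h.sub_le hab (c := -α (v b)) (hg.mono fun s hs hsI =>
    (hs hsI (habove s (Ioo_subset_Icc_self hsI))).trans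
      (neg_le_neg (hα (hanti (Ioo_subset_Icc_self hsI) ⟨hab, le_rfl⟩ hsI.2.le))))
  linarith

lemma eventually_le (h : ∀ T, a ≤ T → HasDerivLEOn v g a T) {c η T₀ : ℝ}
    (hv : ∀ t, a ≤ t → c ≤ v t) (hη : 0 < η) (hT₀ : a ≤ T₀)
    (hg : ∀ᵐ s, T₀ < s → l < v s → g s ≤ -η) : ∀ᶠ t in atTop, v t ≤ l := by
  obtain ⟨t₁, ht₁, hle⟩ : ∃ t₁, T₀ ≤ t₁ ∧ v t₁ ≤ l := by
    by_contra! hcon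
    have hpos : 0 ≤ (v T₀ - c) / η := div_nonneg (sub_nonneg.2 (hv T₀ hT₀)) hη.le
    set t := T₀ + ((v T₀ - c) / η + 1) with ht
    have htT : T₀ ≤ t := by linarith
    have hsub := ((h t (hT₀.trans htT)).mono hT₀ htT le_rfl).sub_le htT (c := -η)
      (hg.mono fun s hs hsI => hs hsI.1 (hcon s hsI.1.le))
    have heq : -η * (t - T₀) = -(v T₀ - c) - η := by
      rw [ht]
      field_simp
      ring
    linarith [hv t (hT₀.trans htT)]
  filter_upwards [eventually_ge_atTop t₁] with t ht
  have hat₁ := hT₀.trans ht₁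
  exact ((h t (hat₁.trans ht)).mono hat₁ ht le_rfl).le_of_le ht (hg.mono fun s hs hsI hls =>
    (hs (ht₁.trans_lt hsI.1) hls).trans (neg_nonpos.2 hη.le)) hle

end HasDerivLEOn

/-! ### Comparison functions -/

section Comparison

variable {α : ℝ ≃o ℝ} {s t : ℝ}

lemma isClassKInfty_orderIso (hα : α 0 = 0) : IsClassKInfty α :=
  ⟨⟨α.continuous.continuousOn, α.strictMono.strictMonoOn _, hα⟩, α.tendsto_atTop⟩

lemma orderIso_symm_zero (hα : α 0 = 0) : α.symm 0 = 0 := by rw [OrderIso.symm_apply_eq, hα]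

lemma orderIso_nonneg (hα : α 0 = 0) (hs : 0 ≤ s) : 0 ≤ α s := hα.ge.trans (α.monotone hs)

/-- A class `KL` function bounding the solutions of `v' ≤ -α(v)`, see `le_decayKL`. -/
noncomputable def decayKL (α : ℝ ≃o ℝ) (s t : ℝ) : ℝ := α.symm ((α s + s) / (1 + t))

lemma continuous_decayKL (α : ℝ ≃o ℝ) (t : ℝ) : Continuous fun s => decayKL α s t :=
  α.symm.continuous.comp ((α.continuous.add continuous_id).div_const _)

lemma isClassKL_decayKL (hα : α 0 = 0) : IsClassKL (decayKL α) where
  continuousOn := by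
    refine α.symm.continuous.comp_continuousOn (ContinuousOn.div ?_ (by fun_prop) fun x hx => ?_)
    · exact ((α.continuous.comp continuous_fst).add continuous_fst).continuousOn
    · have : 0 ≤ x.2 := hx.2
      positivity
  isClassK t ht :=
    { continuousOn := (continuous_decayKL α t).continuousOn
      strictMonoOn := fun s _ s' _ hss' => α.symm.strictMono (div_lt_div_of_pos_right
        (add_lt_add (α.strictMono hss') hss') (by positivity))
      map_zero := by simp only [decayKL, hα, add_zero, zero_div, orderIso_symm_zero hα] }
  antitoneOn s hs t ht t' _ htt' := α.symm.monotone (div_le_div_of_nonneg_left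
    (add_nonneg (orderIso_nonneg hα hs) hs) (add_pos_of_pos_of_nonneg one_pos ht)
    (add_le_add_right htt' 1))
  tendsto_zero s _ := by
    have hlim : Tendsto (fun t : ℝ => (α s + s) / (1 + t)) atTop (𝓝 0) :=
      tendsto_const_nhds.div_atTop (tendsto_atTop_add_const_left _ _ tendsto_id)
    exact (orderIso_symm_zero hα) ▸ (α.symm.continuous.tendsto 0).comp hlim

lemma decayKL_nonneg (hα : α 0 = 0) (hs : 0 ≤ s) (ht : 0 ≤ t) : 0 ≤ decayKL α s t := by
  have hαs := orderIso_nonneg hα hs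
  exact orderIso_nonneg (orderIso_symm_zero hα) (by positivity)

lemma le_decayKL (hα : α 0 = 0) {v : ℝ} (hv : 0 ≤ v) (ht : 0 ≤ t) (h : α v * t + v ≤ s) :
    v ≤ decayKL α s t := by
  have hαv : 0 ≤ α v * t := mul_nonneg (orderIso_nonneg hα hv) ht
  have hvs : α v ≤ α s := α.monotone (by linarith)
  rw [decayKL, OrderIso.le_symm_apply, le_div_iff₀ (by positivity)]
  linarith

/-- The average of `m` over `[s, 2s]`: a continuous function squeezed between `m s` and
`m (2 * s)` when `m` is monotone and vanishes on the negative half-line. -/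
noncomputable def dilationAverage (m : ℝ → ℝ) (s : ℝ) : ℝ := ∫ τ in (1 : ℝ)..2, m (s * τ)

section DilationAverage

variable {m : ℝ → ℝ}

lemma intervalIntegrable_comp_mul_left (hm : Monotone m) (s : ℝ) :
    IntervalIntegrable (fun τ => m (s * τ)) volume 1 2 := by
  rcases le_total 0 s with hs | hs
  · exact (hm.comp fun _ _ h => mul_le_mul_of_nonneg_left h hs).intervalIntegrable
  · exact (hm.comp_antitone fun _ _ h => mul_le_mul_of_nonpos_left h hs).intervalIntegrable

lemma dilationAverage_mono (hm : Monotone m) : Monotone (dilationAverage m) := fun s t hst =>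
  intervalIntegral.integral_mono_on one_le_two (intervalIntegrable_comp_mul_left hm s)
    (intervalIntegrable_comp_mul_left hm t) fun _ hτ =>
      hm (mul_le_mul_of_nonneg_right hst (zero_le_one.trans hτ.1))

lemma dilationAverage_eq_zero (hm0 : ∀ s ≤ 0, m s = 0) (hs : s ≤ 0) : dilationAverage m s = 0 := by
  refine (intervalIntegral.integral_congr (g := 0) fun τ hτ => ?_).trans
    intervalIntegral.integral_zero
  rw [uIcc_of_le one_le_two] at hτ
  exact hm0 _ (mul_nonpos_of_nonpos_of_nonneg hs (zero_le_one.trans hτ.1))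

lemma le_dilationAverage (hm : Monotone m) (hs : 0 ≤ s) : m s ≤ dilationAverage m s := by
  have hle := intervalIntegral.integral_mono_on one_le_two (intervalIntegrable_const (c := m s))
    (intervalIntegrable_comp_mul_left hm s) fun τ hτ => hm (le_mul_of_one_le_right hs hτ.1)
  norm_num at hle
  exact hle

lemma dilationAverage_le (hm : Monotone m) (hs : 0 ≤ s) : dilationAverage m s ≤ m (s * 2) := by
  have hle := intervalIntegral.integral_mono_on one_le_two (intervalIntegrable_comp_mul_left hm s)
    (intervalIntegrable_const (c := m (s * 2))) fun τ hτ =>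
      hm (mul_le_mul_of_nonneg_left hτ.2 hs)
  norm_num at hle
  exact hle

lemma continuousAt_dilationAverage (hm : Monotone m) (hs : s ≠ 0) :
    ContinuousAt (dilationAverage m) s := by
  have hint : ∀ a b, IntervalIntegrable m volume a b := fun a b => hm.intervalIntegrable
  have hprim := intervalIntegral.continuous_primitive hint 0
  have hcont : ContinuousAt
      (fun t => t⁻¹ * ((∫ τ in (0 : ℝ)..t * 2, m τ) - ∫ τ in (0 : ℝ)..t, m τ)) s :=
    (continuousAt_inv₀ hs).mul
      ((hprim.comp (continuous_id.mul continuous_const)).sub hprim).continuousAt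
  refine hcont.congr ?_
  filter_upwards [isOpen_ne.mem_nhds hs] with t ht
  rw [dilationAverage, intervalIntegral.integral_comp_mul_left _ ht,
    intervalIntegral.integral_interval_sub_left (hint _ _) (hint _ _), mul_one, smul_eq_mul]

lemma continuous_dilationAverage (hm : Monotone m) (hm0 : ∀ s ≤ 0, m s = 0)
    (hmc : ContinuousAt m 0) : Continuous (dilationAverage m) := by
  refine continuous_iff_continuousAt.2 fun s => ?_
  rcases eq_or_ne s 0 with rfl | hs
  swap
  · exact continuousAt_dilationAverage hm hs
  have hlim : Tendsto (fun t : ℝ => m (t * 2)) (𝓝 0) (𝓝 0) := by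
    have h2 : Tendsto (fun t : ℝ => t * 2) (𝓝 0) (𝓝 0) := by
      simpa using (continuous_mul_const (2 : ℝ)).tendsto 0
    have hm2 := hmc.tendsto.comp h2
    rwa [hm0 0 le_rfl] at hm2
  rw [ContinuousAt, dilationAverage_eq_zero hm0 le_rfl]
  refine squeeze_zero (fun t => ?_) (fun t => ?_) hlim
  · exact (dilationAverage_eq_zero hm0 (min_le_right t 0)).ge.trans
      (dilationAverage_mono hm (min_le_left t 0))
  · rcases le_total t 0 with ht | ht
    · rw [dilationAverage_eq_zero hm0 ht, hm0 _ (by linarith)]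
    · exact dilationAverage_le hm ht

lemma exists_orderIso_ge (hm : Monotone m) (hm0 : ∀ s ≤ 0, m s = 0) (hmc : ContinuousAt m 0) :
    ∃ σ : ℝ ≃o ℝ, σ 0 = 0 ∧ ∀ s, 0 ≤ s → m s ≤ σ s := by
  have hmono := dilationAverage_mono hm
  have hzero : ∀ s ≤ 0, dilationAverage m s = 0 := fun s => dilationAverage_eq_zero hm0
  have hnonneg : ∀ s, 0 ≤ dilationAverage m s := fun s =>
    (hzero _ (min_le_right s 0)).ge.trans (hmono (min_le_left s 0))
  have hstrict : StrictMono fun s => dilationAverage m s + s := fun s t hst =>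
    add_lt_add_of_le_of_lt (hmono hst.le) hst
  have hsurj : Function.Surjective fun s => dilationAverage m s + s := by
    refine ((continuous_dilationAverage hm hm0 hmc).add continuous_id).surjective ?_ ?_
    · exact tendsto_atTop_mono (fun s => le_add_of_nonneg_left (hnonneg s)) tendsto_id
    · refine (tendsto_id (α := ℝ)).congr' ?_
      filter_upwards [eventually_le_atBot 0] with s hs
      rw [Pi.add_apply, hzero s hs, zero_add]
  refine ⟨hstrict.orderIsoOfSurjective _ hsurj, ?_, fun s hs => ?_⟩
  · simp only [StrictMono.coe_orderIsoOfSurjective, hzero 0 le_rfl, add_zero]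
  · exact (le_dilationAverage hm hs).trans (le_add_of_nonneg_right hs)

end DilationAverage

section SublevelSup

variable {X : Type*} {W₁ W₂ : X → ℝ}

/-- The supremum of `W₂` over the sublevel set `{W₁ ≤ s}`; it is `0` if that set is empty. -/
noncomputable def sublevelSup (W₁ W₂ : X → ℝ) (s : ℝ) : ℝ := sSup (W₂ '' {x | W₁ x ≤ s})

lemma sublevelSup_le {c : ℝ} (hc : 0 ≤ c) (h : ∀ x, W₁ x ≤ s → W₂ x ≤ c) :
    sublevelSup W₁ W₂ s ≤ c :=
  Real.sSup_le (forall_mem_image.2 h) hc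

lemma sublevelSup_nonneg (hW₂ : ∀ x, 0 ≤ W₂ x) (s : ℝ) : 0 ≤ sublevelSup W₁ W₂ s :=
  Real.sSup_nonneg (forall_mem_image.2 fun x _ => hW₂ x)

lemma sublevelSup_eq_zero (hW₁ : ∀ x, 0 ≤ W₁ x) (hW₂ : ∀ x, 0 ≤ W₂ x)
    (hz : ∀ x, W₁ x = 0 → W₂ x = 0) (hs : s ≤ 0) : sublevelSup W₁ W₂ s = 0 :=
  le_antisymm (sublevelSup_le le_rfl fun x hx => (hz x ((hx.trans hs).antisymm (hW₁ x))).le)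
    (sublevelSup_nonneg hW₂ s)

variable [TopologicalSpace X]

lemma le_sublevelSup (h₂ : Continuous W₂) (hcpt : ∀ M, 0 < M → IsCompact {x | W₁ x ≤ M})
    {x : X} (hx : W₁ x ≤ s) : W₂ x ≤ sublevelSup W₁ W₂ s := by
  have hbdd : BddAbove (W₂ '' {x | W₁ x ≤ max s 1}) :=
    (hcpt _ (by positivity)).bddAbove_image h₂.continuousOn
  have hsub : {x | W₁ x ≤ s} ⊆ {x | W₁ x ≤ max s 1} := fun x hx =>
    mem_ofPred.2 (le_max_of_le_left hx)
  exact le_csSup (hbdd.mono (image_mono hsub)) (mem_image_of_mem W₂ hx)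

lemma sublevelSup_mono (h₂ : Continuous W₂) (hcpt : ∀ M, 0 < M → IsCompact {x | W₁ x ≤ M})
    (hW₂ : ∀ x, 0 ≤ W₂ x) : Monotone (sublevelSup W₁ W₂) := fun _ t hst =>
  sublevelSup_le (sublevelSup_nonneg hW₂ t) fun _ hx => le_sublevelSup h₂ hcpt (hx.trans hst)

lemma continuousAt_sublevelSup_zero (h₁ : Continuous W₁) (h₂ : Continuous W₂)
    (hcpt : ∀ M, 0 < M → IsCompact {x | W₁ x ≤ M}) (hW₁ : ∀ x, 0 ≤ W₁ x) (hW₂ : ∀ x, 0 ≤ W₂ x)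
    (hz : ∀ x, W₁ x = 0 → W₂ x = 0) : ContinuousAt (sublevelSup W₁ W₂) 0 := by
  rw [ContinuousAt, sublevelSup_eq_zero hW₁ hW₂ hz le_rfl]
  refine tendsto_order.2 ⟨fun η hη => .of_forall fun s => hη.trans_le (sublevelSup_nonneg hW₂ s),
    fun η hη => ?_⟩
  have hK : IsCompact ({x | W₁ x ≤ 1} ∩ {x | η / 2 ≤ W₂ x}) :=
    (hcpt 1 one_pos).inter_right (isClosed_le continuous_const h₂)
  -- `W₁` is bounded below by a positive constant on the part of `{W₁ ≤ 1}` where `W₂` is not small.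
  obtain ⟨c, hc, hcK⟩ := hK.exists_forall_le' h₁.continuousOn (a := 0) fun x hx =>
    (hW₁ x).lt_of_ne' fun h => by
      have hle : η / 2 ≤ W₂ x := hx.2
      linarith [hz x h]
  filter_upwards [Iio_mem_nhds (lt_min one_pos hc)] with s hs
  refine (sublevelSup_le (half_pos hη).le fun x hx => ?_).trans_lt (half_lt_self hη)
  have hx' := hx.trans_lt hs
  by_contra! hlt
  exact (hcK x ⟨(hx'.trans_le (min_le_left _ _)).le, hlt.le⟩).not_gt
    (hx'.trans_le (min_le_right _ _))

lemma exists_orderIso_dominating (h₁ : Continuous W₁) (h₂ : Continuous W₂)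
    (hcpt : ∀ M, 0 < M → IsCompact {x | W₁ x ≤ M}) (hW₁ : ∀ x, 0 ≤ W₁ x) (hW₂ : ∀ x, 0 ≤ W₂ x)
    (hz : ∀ x, W₁ x = 0 → W₂ x = 0) : ∃ σ : ℝ ≃o ℝ, σ 0 = 0 ∧ ∀ x, W₂ x ≤ σ (W₁ x) := by
  obtain ⟨σ, hσ0, hσ⟩ := exists_orderIso_ge (sublevelSup_mono h₂ hcpt hW₂)
    (fun _ => sublevelSup_eq_zero hW₁ hW₂ hz)
    (continuousAt_sublevelSup_zero h₁ h₂ hcpt hW₁ hW₂ hz)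
  exact ⟨σ, hσ0, fun x => (le_sublevelSup h₂ hcpt le_rfl).trans (hσ _ (hW₁ x))⟩

end SublevelSup

end Comparison

namespace IsSmoothProperPosDef

variable {j : ℕ} {V : Vec j → ℝ} (hV : IsSmoothProperPosDef V)
include hV

lemma continuous : Continuous V := hV.smooth.continuous

lemma locallyLipschitz : LocallyLipschitz V := (hV.smooth.of_le (by simp)).locallyLipschitz

lemma hasDerivAt_comp {y : ℝ → Vec j} {v : Vec j} {s : ℝ} (hy : HasDerivAt y v s) :
    HasDerivAt (fun t => V (y t)) (fderiv ℝ V (y s) v) s :=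
  ((hV.smooth.differentiable (by simp)) (y s)).hasFDerivAt.comp_hasDerivAt s hy

lemma nonneg (y : Vec j) : 0 ≤ V y := by
  rcases eq_or_ne y 0 with rfl | h
  · exact hV.map_zero.ge
  · exact (hV.pos y h).le

lemma eq_zero {y : Vec j} (h : V y = 0) : y = 0 := by
  by_contra hne
  exact (hV.pos y hne).ne' h

lemma exists_orderIso_dominating {W : Vec j → ℝ} (hW : Continuous W) (hW0 : W 0 = 0)
    (hWn : ∀ x, 0 ≤ W x) : ∃ σ : ℝ ≃o ℝ, σ 0 = 0 ∧ ∀ x, W x ≤ σ (V x) :=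
  DADS.exists_orderIso_dominating hV.continuous hW hV.radiallyUnbounded hV.nonneg hWn
    fun x hx => by rw [hV.eq_zero hx, hW0]

lemma tendsto_norm_zero {y : ℝ → Vec j} (h : Tendsto (fun t => V (y t)) atTop (𝓝 0)) :
    Tendsto (fun t => ‖y t‖) atTop (𝓝 0) := by
  obtain ⟨σ, hσ0, hσ⟩ := hV.exists_orderIso_dominating continuous_norm norm_zero norm_nonneg
  have hlim : Tendsto (fun t => σ (V (y t))) atTop (𝓝 0) := by
    exact hσ0 ▸ (σ.continuous.tendsto 0).comp h
  exact squeeze_zero (fun t => norm_nonneg _) (fun t => hσ _) hlim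

end IsSmoothProperPosDef

/-! ### Nonlinear damping -/

section Damping

variable {e G κ c m l X₀ X Y₀ Y τ s D q R Λ : ℝ}

lemma le_add_of_sq_le_four_mul {p A B : ℝ} (hA : 0 ≤ A) (hB : 0 ≤ B) (h : p ^ 2 ≤ 4 * A * B) :
    p ≤ A + B :=
  le_of_abs_le (abs_le_of_sq_le_sq (h.trans (four_mul_le_sq_add A B)) (add_nonneg hA hB))

lemma mul_mul_le_of_sq_le (he : 0 < e) (hG : 0 ≤ G) (hm : 0 < m) (hcG : c ^ 2 ≤ e * G) (Z : ℝ)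
    {t : ℝ} (ht : 0 < t) : l * Z * c ≤ e / (t * m) * Z ^ 2 + t * G * m * l ^ 2 / 4 := by
  refine le_add_of_sq_le_four_mul (by positivity) (by positivity) ?_
  calc (l * Z * c) ^ 2 = (l * Z) ^ 2 * c ^ 2 := mul_pow _ _ _
    _ ≤ (l * Z) ^ 2 * (e * G) := by gcongr
    _ = 4 * (e / (t * m) * Z ^ 2) * (t * G * m * l ^ 2 / 4) := by field_simp

lemma mul_mul_le_add_sq (hG : 0 ≤ G) (hκ : 0 ≤ κ) (hGκ : 1 ≤ G * κ) (Z : ℝ) :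
    l * Z * s ≤ G * Z ^ 2 * l ^ 2 + κ * s ^ 2 := by
  refine le_add_of_sq_le_four_mul (by positivity) (by positivity) ?_
  calc (l * Z * s) ^ 2 ≤ (l * Z * s) ^ 2 * (4 * (G * κ)) :=
        le_mul_of_one_le_right (sq_nonneg _) (by linarith)
    _ = 4 * (G * Z ^ 2 * l ^ 2) * (κ * s ^ 2) := by ring

lemma mul_mul_le_add_pow_four (he : 0 < e) (hG : 0 ≤ G) (hκ : 0 ≤ κ) (hm : 0 < m)
    (heGκ : 1 ≤ e ^ 2 * G * κ) (Z : ℝ) :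
    l * Z * s ≤ e / (2 * m) * Z ^ 2 + (G * m ^ 2 * l ^ 4 / 4 + κ * s ^ 4) := by
  have hZ : l * Z * s ≤ e / (2 * m) * Z ^ 2 + m * l ^ 2 * s ^ 2 / (2 * e) := by
    refine le_add_of_sq_le_four_mul (by positivity) (by positivity) (le_of_eq ?_)
    field_simp
    ring
  have hs : m * l ^ 2 * s ^ 2 / (2 * e) ≤ G * m ^ 2 * l ^ 4 / 4 + κ * s ^ 4 := by
    refine le_add_of_sq_le_four_mul (by positivity) (by positivity) ?_
    calc (m * l ^ 2 * s ^ 2 / (2 * e)) ^ 2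
        ≤ (m * l ^ 2 * s ^ 2 / (2 * e)) ^ 2 * (4 * (e ^ 2 * G * κ)) :=
          le_mul_of_one_le_right (sq_nonneg _) (by linarith)
      _ = 4 * (G * m ^ 2 * l ^ 4 / 4) * (κ * s ^ 4) := by
          field_simp
          ring
  exact hZ.trans (add_le_add_right hs _)

/-- Young's inequality splits each cross term into a part absorbed by the dissipation `e * (q + R)`,
a part with the small coefficient `κ`, and a part paid for by the damping of strength `G`. -/
lemma damping_estimate (he : 0 < e) (he1 : e ≤ 1) (hG : 1 ≤ G) (hκ : 0 < κ)
    (hcG : c ^ 2 ≤ e * G) (heGκ : 1 ≤ e ^ 2 * G * κ) (hm : 0 < m) (hl : 0 ≤ l)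
    (hX₀ : 0 ≤ X₀) (hX : 0 ≤ X) (hτ : τ ≤ c + s) (hXY : X ^ 2 + Y ^ 2 ≤ m * (R + Λ))
    (hX₀q : X₀ ^ 2 ≤ m * (q + Λ + l ^ 2)) :
    l * (X₀ + X) * τ + l * (Y₀ + Y) * D
      ≤ e * (q + R + 2 * Λ) + κ * (s ^ 2 + s ^ 4 + D ^ 2 + D ^ 4)
        + G * (m ^ 2 * l ^ 4 + (Y₀ ^ 2 + X₀ ^ 2 + m + 1) * l ^ 2) := by
  have hG0 : 0 ≤ G := zero_le_one.trans hG
  have hGκ : 1 ≤ G * κ := heGκ.trans (by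
    rw [mul_assoc]
    exact mul_le_of_le_one_left (by positivity) (pow_le_one₀ he.le he1))
  have hτ' : l * (X₀ + X) * τ ≤ l * (X₀ + X) * (c + s) := by gcongr
  have hXY' : e / m * X ^ 2 + e / m * Y ^ 2 ≤ e * (R + Λ) := by
    calc e / m * X ^ 2 + e / m * Y ^ 2 = e / m * (X ^ 2 + Y ^ 2) := (mul_add _ _ _).symm
      _ ≤ e / m * (m * (R + Λ)) := by gcongr
      _ = e * (R + Λ) := by field_simp
  have hX₀' : e / m * X₀ ^ 2 ≤ e * (q + Λ) + G * l ^ 2 := by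
    calc e / m * X₀ ^ 2 ≤ e / m * (m * (q + Λ + l ^ 2)) := by gcongr
      _ = e * (q + Λ) + e * l ^ 2 := by field_simp
      _ ≤ e * (q + Λ) + G * l ^ 2 := by gcongr; exact he1.trans hG
  have hX₀c := mul_mul_le_of_sq_le (l := l) he hG0 hm hcG X₀ one_pos
  have hXc := mul_mul_le_of_sq_le (l := l) he hG0 hm hcG X two_pos
  have hX₀s := mul_mul_le_add_sq (l := l) (s := s) hG0 hκ.le hGκ X₀
  have hY₀D := mul_mul_le_add_sq (l := l) (s := D) hG0 hκ.le hGκ Y₀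
  have hXs := mul_mul_le_add_pow_four (l := l) (s := s) he hG0 hκ.le hm heGκ X
  have hYD := mul_mul_le_add_pow_four (l := l) (s := D) he hG0 hκ.le hm heGκ Y
  have hhalf : ∀ Z : ℝ, e / (2 * m) * Z ^ 2 = e / m * Z ^ 2 / 2 := fun Z => by field_simp
  have hGm : 0 ≤ G * m * l ^ 2 := by positivity
  have hGm4 : 0 ≤ G * m ^ 2 * l ^ 4 := by positivity
  have hY : 0 ≤ e / m * Y ^ 2 := by positivity
  rw [one_mul] at hX₀c
  rw [hhalf] at hXc hXs hYD
  linarith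

lemma inner_mul_le {E : Type*} [NormedAddCommGroup E] [InnerProductSpace ℝ E] (v v₀ d : E)
    (L : ℝ) : inner ℝ v d * L ≤ |L| * (‖v₀‖ + ‖v - v₀‖) * ‖d‖ := by
  calc inner ℝ v d * L ≤ |inner ℝ v d| * |L| := (le_abs_self _).trans (abs_mul _ _).le
    _ ≤ (‖v₀‖ + ‖v - v₀‖) * ‖d‖ * |L| := by
        gcongr
        exact (abs_real_inner_le_norm _ _).trans
          (mul_le_mul_of_nonneg_right (norm_le_norm_add_norm_sub' _ _) (norm_nonneg _))
    _ = |L| * (‖v₀‖ + ‖v - v₀‖) * ‖d‖ := by ring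

end Damping

variable {n l m p q : ℕ}

/-! ### The closed loop -/

/-- The state space of the closed loop, with points `(y, w, z)`. -/
abbrev State (n l : ℕ) : Type := Vec n × Vec l × ℝ

/-- A plant satisfying Assumption (A), together with admissible controller parameters. -/
structure Design (n l m p q : ℕ) where
  S : Plant n l m p q
  V : Vec n → ℝ
  Q : Vec n → ℝ
  k : Vec n → ℝ
  Φ : Vec l → ℝ
  R : Vec l → ℝ
  μ : Vec n → ℝ
  r : ℝ
  Λ : ℝ
  γ : ℝ → ℝ
  ε : ℝ
  Γ : ℝ
  a : ℝ
  β : ℝ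
  b : ℝ
  C : ℝ
  assumptionA : AssumptionA S V Q k Φ R μ r Λ γ
  ε_pos : 0 < ε
  Γ_pos : 0 < Γ
  a_pos : 0 < a
  a_le_one : a ≤ 1
  β_pos : 0 < β
  β_le_one : β ≤ 1
  one_le_b : 1 ≤ b
  one_le_C : 1 ≤ C
  two_mul_a_mul_β_lt : 2 * a * β < b * r

/-- The essentially bounded inputs `d, θ, δ` of the closed loop. -/
structure Inputs (m p q : ℕ) where
  d : ℝ → Vec m
  θ : ℝ → Vec p
  δ : ℝ → Vec q
  isLInfty_d : IsLInfty d
  isLInfty_θ : IsLInfty θ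
  isLInfty_δ : IsLInfty δ

lemma supNorm_nonneg {j : ℕ} (d : ℝ → Vec j) : 0 ≤ supNorm d := ENNReal.toReal_nonneg

lemma IsLInfty.ae_norm_le {j : ℕ} {d : ℝ → Vec j} (hd : IsLInfty d) :
    ∀ᵐ t, 0 ≤ t → ‖d t‖ ≤ supNorm d := by
  have hle := ae_le_eLpNormEssSup (f := d) (μ := volume.restrict (Ici (0 : ℝ)))
  rw [ae_restrict_iff' measurableSet_Ici] at hle
  filter_upwards [hle] with t ht ht0
  have ht' := ht ht0
  rw [← eLpNorm_exponent_top] at ht'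
  simpa only [supNorm, toReal_enorm] using ENNReal.toReal_mono hd.2.ne ht'

namespace Inputs

variable (I : Inputs m p q)

/-- The norms `(‖d‖_∞, ‖δ‖_∞, ‖θ‖_∞)`, in the order in which `χ` and the bound on the gain
take them. -/
noncomputable def norms : ℝ × ℝ × ℝ := (supNorm I.d, supNorm I.δ, supNorm I.θ)

/-- The values `(d, θ, δ)` of the inputs at time `t`. -/
def eval (t : ℝ) : Vec m × Vec p × Vec q := (I.d t, I.θ t, I.δ t)

lemma ae_norm_le :
    ∀ᵐ t, 0 ≤ t → ‖I.d t‖ ≤ supNorm I.d ∧ ‖I.θ t‖ ≤ supNorm I.θ ∧ ‖I.δ t‖ ≤ supNorm I.δ := by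
  filter_upwards [I.isLInfty_d.ae_norm_le, I.isLInfty_θ.ae_norm_le, I.isLInfty_δ.ae_norm_le]
    with t hd hθ hδ ht using ⟨hd ht, hθ ht, hδ ht⟩

end Inputs

namespace Design

variable (D : Design n l m p q)

/-- The right-hand side of the closed loop as a function of the state `(y, w, z)` and of the
values of the inputs `(d, θ, δ)`. -/
noncomputable def vectorField (u : State n l × (Vec m × Vec p × Vec q)) : State n l :=
  closedLoop D.S D.V D.k D.μ D.ε D.Γ D.a D.β D.b D.C (fun _ => u.2.1) (fun _ => u.2.2.1)
    (fun _ => u.2.2.2) 0 u.1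

/-- The Carathéodory solutions of the closed loop driven by the inputs `I`. -/
abbrev IsSolution (I : Inputs m p q) (x₀ : State n l) (J : Set ℝ) (x : ℝ → State n l) : Prop :=
  IsCaratheodorySolution
    (closedLoop D.S D.V D.k D.μ D.ε D.Γ D.a D.β D.b D.C I.d I.θ I.δ) x₀ J x

/-- The Lyapunov function `U = V + (r/2) Φ` on the state space. -/
noncomputable abbrev U (x : State n l) : ℝ := lyapU D.V D.Φ D.r x.1 x.2.1

/-- The gain `χ` from the inputs to `U`. -/
noncomputable abbrev χ (s₁ s₂ s₃ s₄ : ℝ) : ℝ := chi D.γ D.r D.Λ D.a D.β D.b s₁ s₂ s₃ s₄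

/-- The numerator of the fraction in `χ`. -/
noncomputable def disturbance (s₁ s₃ s₄ : ℝ) : ℝ :=
  s₁ ^ 2 + s₁ ^ 4 + max (s₃ - D.b - s₄) 0 ^ 2 + max (s₃ - D.b - s₄) 0 ^ 4 + 2 * D.β * D.Λ

/-- The decay rate of `U` relative to `Q + R`. -/
noncomputable def rate : ℝ := D.r / 2 - D.a * D.β / D.b

lemma b_pos : 0 < D.b := one_pos.trans_le D.one_le_b

lemma r_pos : 0 < D.r := D.assumptionA.r_pos

lemma rate_pos : 0 < D.rate := by
  rw [rate, sub_pos, div_lt_div_iff₀ D.b_pos two_pos]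
  linarith [D.two_mul_a_mul_β_lt]

lemma b_add_exp_pos (z : ℝ) : 0 < D.b + Real.exp z := add_pos D.b_pos (Real.exp_pos z)

lemma disturbance_nonneg (s₁ s₃ s₄ : ℝ) : 0 ≤ D.disturbance s₁ s₃ s₄ := by
  have hΛ := D.assumptionA.Λ_nonneg
  have hβ := D.β_pos
  unfold disturbance
  positivity

lemma disturbance_mono {s₁ s₃ s₄ t₁ t₃ t₄ : ℝ} (h₁ : 0 ≤ s₁) (h₁' : s₁ ≤ t₁) (h₃ : s₃ ≤ t₃)
    (h₄ : t₄ ≤ s₄) : D.disturbance s₁ s₃ s₄ ≤ D.disturbance t₁ t₃ t₄ := by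
  unfold disturbance
  gcongr

lemma χ_eq (s₁ s₂ s₃ s₄ : ℝ) :
    D.χ s₁ s₂ s₃ s₄ = D.r / 2 * D.γ s₂ + D.a * (D.disturbance s₁ s₃ s₄ / (D.b + s₄)) := rfl

lemma χ_nonneg {s₂ s₄ : ℝ} (h₂ : 0 ≤ s₂) (h₄ : 0 ≤ s₄) (s₁ s₃ : ℝ) : 0 ≤ D.χ s₁ s₂ s₃ s₄ := by
  have hγ := D.assumptionA.γ_prop.nonneg s₂ h₂
  have hN := D.disturbance_nonneg s₁ s₃ s₄
  have ⟨hr, ha, hb⟩ := And.intro D.r_pos (And.intro D.a_pos D.b_pos)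
  rw [χ_eq]
  positivity

lemma χ_mono {s₁ s₂ s₃ s₄ t₁ t₂ t₃ t₄ : ℝ} (h₁ : 0 ≤ s₁) (h₂ : 0 ≤ s₂) (h₄ : 0 ≤ t₄)
    (h₁' : s₁ ≤ t₁) (h₂' : s₂ ≤ t₂) (h₃' : s₃ ≤ t₃) (h₄' : t₄ ≤ s₄) :
    D.χ s₁ s₂ s₃ s₄ ≤ D.χ t₁ t₂ t₃ t₄ := by
  have hγ := D.assumptionA.γ_prop.monotoneOn h₂ (h₂.trans h₂') h₂'
  have hN := D.disturbance_mono h₁ h₁' h₃' h₄'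
  have hN0 := D.disturbance_nonneg t₁ t₃ t₄
  have ⟨hr, ha, hb⟩ := And.intro D.r_pos (And.intro D.a_pos D.b_pos)
  simp only [χ_eq]
  gcongr

lemma continuous_χ :
    Continuous fun s : ℝ × ℝ × ℝ × ℝ => D.χ s.1 (max s.2.1 0) s.2.2.1 (Real.exp s.2.2.2) := by
  have hγ : Continuous fun s : ℝ × ℝ × ℝ × ℝ => D.γ (max s.2.1 0) :=
    D.assumptionA.γ_prop.continuousOn.comp_continuous (by fun_prop) fun s =>
      mem_Ici.2 (le_max_right _ _)
  unfold χ chi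
  refine (continuous_const.mul hγ).add (continuous_const.mul (Continuous.div ?_ ?_ ?_))
  · fun_prop
  · fun_prop
  · exact fun s => (D.b_add_exp_pos _).ne'

lemma U_nonneg (x : State n l) : 0 ≤ D.U x :=
  add_nonneg (D.assumptionA.V_prop.nonneg _)
    (mul_nonneg (half_pos D.r_pos).le (D.assumptionA.Φ_prop.nonneg _))

lemma V_le_U (x : State n l) : D.V x.1 ≤ D.U x :=
  le_add_of_nonneg_right (mul_nonneg (half_pos D.r_pos).le (D.assumptionA.Φ_prop.nonneg _))

lemma Φ_le_U (x : State n l) : D.Φ x.2.1 ≤ 2 / D.r * D.U x := by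
  rw [div_mul_eq_mul_div, le_div_iff₀ D.r_pos, U, lyapU]
  linarith [D.assumptionA.V_prop.nonneg x.1]

lemma contDiff_U : ContDiff ℝ ∞ D.U :=
  (D.assumptionA.V_prop.smooth.comp contDiff_fst).add
    (contDiff_const.mul (D.assumptionA.Φ_prop.smooth.comp (contDiff_fst.comp contDiff_snd)))

section Regularity

lemma contDiff_control :
    ContDiff ℝ ∞ fun v : Vec n × ℝ => control D.S D.V D.k D.μ D.a D.β D.b D.C v.1 v.2 := by
  have hVg : ContDiff ℝ ∞ fun v : Vec n × ℝ => fderiv ℝ D.V v.1 (D.S.g v.1) :=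
    ((D.assumptionA.V_prop.smooth.fderiv_right (by simp)).clm_apply D.S.smooth_g).comp contDiff_fst
  have hk : ContDiff ℝ ∞ fun v : Vec n × ℝ => D.k v.1 := D.assumptionA.k_smooth.comp contDiff_fst
  have hμ : ContDiff ℝ ∞ fun v : Vec n × ℝ => D.μ v.1 := D.assumptionA.μ_smooth.comp contDiff_fst
  have hφ : ContDiff ℝ ∞ fun v : Vec n × ℝ => ‖D.S.φ v.1 0‖ ^ 2 :=
    (D.S.smooth_φ.comp (contDiff_fst.prodMk contDiff_const)).norm_sq ℝ
  have hA : ContDiff ℝ ∞ fun v : Vec n × ℝ => ‖D.S.A v.1 0‖ ^ 2 :=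
    (D.S.smooth_A.comp (contDiff_fst.prodMk contDiff_const)).norm_sq ℝ
  unfold control
  fun_prop

lemma contDiff_vectorField_fst : ContDiff ℝ ∞ fun u => (D.vectorField u).1 := by
  have hf : ContDiff ℝ ∞ fun u : State n l × (Vec m × Vec p × Vec q) => D.S.f u.1.1 :=
    D.S.smooth_f.comp (by fun_prop)
  have hg : ContDiff ℝ ∞ fun u : State n l × (Vec m × Vec p × Vec q) => D.S.g u.1.1 :=
    D.S.smooth_g.comp (by fun_prop)
  have hu : ContDiff ℝ ∞ fun u : State n l × (Vec m × Vec p × Vec q) =>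
      control D.S D.V D.k D.μ D.a D.β D.b D.C u.1.1 u.1.2.2 :=
    D.contDiff_control.comp (g := fun v : Vec n × ℝ => _)
      (f := fun u : State n l × (Vec m × Vec p × Vec q) => (u.1.1, u.1.2.2)) (by fun_prop)
  have hyw : ContDiff ℝ ∞ fun u : State n l × (Vec m × Vec p × Vec q) => (u.1.1, u.1.2.1) := by
    fun_prop
  have hφ := (D.S.smooth_φ.comp hyw).inner ℝ
    (by fun_prop : ContDiff ℝ ∞ fun u : State n l × (Vec m × Vec p × Vec q) => u.2.2.1)
  have hA := (D.S.smooth_A.comp hyw).inner ℝ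
    (by fun_prop : ContDiff ℝ ∞ fun u : State n l × (Vec m × Vec p × Vec q) => u.2.1)
  exact hf.add (((hu.add hφ).add hA).smul hg)

lemma locallyLipschitz_excess : LocallyLipschitz fun x : State n l => max (D.V x.1 - D.ε) 0 := by
  have hV : ContDiff ℝ ∞ fun x : State n l => D.V x.1 - D.ε :=
    (D.assumptionA.V_prop.smooth.comp contDiff_fst).sub contDiff_const
  exact (hV.of_le (by simp)).locallyLipschitz.max_const 0

lemma locallyLipschitz_vectorField : LocallyLipschitz D.vectorField := by
  have hw : ContDiff ℝ 1 fun u => (D.vectorField u).2.1 :=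
    (D.S.smooth_h.comp (by fun_prop :
      ContDiff ℝ ∞ fun u : State n l × (Vec m × Vec p × Vec q) => (u.1.1, u.1.2.1, u.2.2.2))).of_le
      (by simp)
  have hz : ContDiff ℝ 1 fun v : ℝ × ℝ => D.Γ * Real.exp (-v.1) * v.2 := by fun_prop
  have hzV : LocallyLipschitz fun u : State n l × (Vec m × Vec p × Vec q) =>
      (u.1.2.2, max (D.V u.1.1 - D.ε) 0) :=
    (by fun_prop : ContDiff ℝ 1 fun u : State n l × (Vec m × Vec p × Vec q) =>
      u.1.2.2).locallyLipschitz.prodMk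
      (D.locallyLipschitz_excess.comp LipschitzWith.prod_fst.locallyLipschitz)
  exact (D.contDiff_vectorField_fst.of_le (by simp)).locallyLipschitz.prodMk
    (hw.locallyLipschitz.prodMk (hz.locallyLipschitz.comp hzV))

lemma isCaratheodoryField (I : Inputs m p q) : IsCaratheodoryField
    (closedLoop D.S D.V D.k D.μ D.ε D.Γ D.a D.β D.b D.C I.d I.θ I.δ) := by
  refine isCaratheodoryField_of_locallyLipschitz (v := I.eval)
    (Mv := max (supNorm I.d) (max (supNorm I.θ) (supNorm I.δ))) D.locallyLipschitz_vectorField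
    (I.isLInfty_d.1.prodMk (I.isLInfty_θ.1.prodMk I.isLInfty_δ.1)) ?_
  filter_upwards [I.ae_norm_le] with t ht ht0
  obtain ⟨hd, hθ, hδ⟩ := ht ht0
  exact max_le_max hd (max_le_max hθ hδ)

end Regularity

/-! ### Dissipation -/

section Dissipation

/-- The common factor `(b + e^z)³ / (a³ β²)` of the damping terms of the controller. -/
noncomputable def dampingGain (z : ℝ) : ℝ := (D.b + Real.exp z) ^ 3 / (D.a ^ 3 * D.β ^ 2)

/-- The decrease of `V` caused by the damping terms of the controller, up to the factor
`C * dampingGain`. -/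
noncomputable def damping (y : Vec n) : ℝ :=
  D.μ y ^ 2 * |fderiv ℝ D.V y (D.S.g y)| ^ 4
    + (‖D.S.A y 0‖ ^ 2 + ‖D.S.φ y 0‖ ^ 2 + D.μ y + 1) * |fderiv ℝ D.V y (D.S.g y)| ^ 2

lemma fderiv_V_vectorField (x : State n l) (v : Vec m × Vec p × Vec q) :
    fderiv ℝ D.V x.1 (D.vectorField (x, v)).1
      = fderiv ℝ D.V x.1 (D.S.f x.1 + D.k x.1 • D.S.g x.1)
        - D.C * (D.dampingGain x.2.2 * D.damping x.1)
        + inner ℝ (D.S.φ x.1 x.2.1) v.2.1 * fderiv ℝ D.V x.1 (D.S.g x.1)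
        + inner ℝ (D.S.A x.1 x.2.1) v.1 * fderiv ℝ D.V x.1 (D.S.g x.1) := by
  have habs : |fderiv ℝ D.V x.1 (D.S.g x.1)| ^ 4 = fderiv ℝ D.V x.1 (D.S.g x.1) ^ 4 :=
    (by decide : Even 4).pow_abs _
  simp only [vectorField, closedLoop, control, dampingGain, damping, map_add, map_smul,
    smul_eq_mul, habs, sq_abs]
  ring

lemma one_le_b_add_exp (z : ℝ) : 1 ≤ D.b + Real.exp z :=
  D.one_le_b.trans (le_add_of_nonneg_right (Real.exp_pos z).le)

lemma one_le_dampingGain (z : ℝ) : 1 ≤ D.dampingGain z := by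
  have ⟨ha, hβ⟩ := And.intro D.a_pos D.β_pos
  refine (one_le_div (by positivity)).2 (le_trans ?_ (one_le_pow₀ (D.one_le_b_add_exp z)))
  exact mul_le_one₀ (pow_le_one₀ ha.le D.a_le_one) (sq_nonneg _) (pow_le_one₀ hβ.le D.β_le_one)

lemma sq_le_mul_dampingGain (z : ℝ) :
    (D.b + Real.exp z) ^ 2 ≤ D.a * D.β / (D.b + Real.exp z) * D.dampingGain z := by
  have ⟨ha, hβ⟩ := And.intro D.a_pos D.β_pos
  have hc := D.b_add_exp_pos z
  rw [dampingGain, div_mul_div_comm, le_div_iff₀ (by positivity)]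
  calc (D.b + Real.exp z) ^ 2 * ((D.b + Real.exp z) * (D.a ^ 3 * D.β ^ 2))
      = D.a * D.β * (D.b + Real.exp z) ^ 3 * (D.a ^ 2 * D.β) := by ring
    _ ≤ D.a * D.β * (D.b + Real.exp z) ^ 3 :=
        mul_le_of_le_one_right (by positivity)
          (mul_le_one₀ (pow_le_one₀ ha.le D.a_le_one) hβ.le D.β_le_one)

lemma cross_terms_le (x : State n l) (d : Vec m) (θ : Vec p) :
    inner ℝ (D.S.φ x.1 x.2.1) θ * fderiv ℝ D.V x.1 (D.S.g x.1)
      + inner ℝ (D.S.A x.1 x.2.1) d * fderiv ℝ D.V x.1 (D.S.g x.1)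
      ≤ D.a * D.β / (D.b + Real.exp x.2.2) * (D.Q x.1 + D.R x.2.1)
        + D.a * (D.disturbance ‖d‖ ‖θ‖ (Real.exp x.2.2) / (D.b + Real.exp x.2.2))
        + D.dampingGain x.2.2 * D.damping x.1 := by
  have ⟨ha, hβ⟩ := And.intro D.a_pos D.β_pos
  have hc := D.b_add_exp_pos x.2.2
  have haβ : D.a * D.β ≤ D.b + Real.exp x.2.2 :=
    (mul_le_one₀ D.a_le_one hβ.le D.β_le_one).trans (D.one_le_b_add_exp x.2.2)
  have hθ : ‖θ‖ ≤ D.b + Real.exp x.2.2 + max (‖θ‖ - D.b - Real.exp x.2.2) 0 := by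
    linarith [le_max_left (‖θ‖ - D.b - Real.exp x.2.2) 0]
  have hest := damping_estimate (Y₀ := ‖D.S.A x.1 0‖) (D := ‖d‖)
    (e := D.a * D.β / (D.b + Real.exp x.2.2)) (κ := D.a / (D.b + Real.exp x.2.2))
    (by positivity) ((div_le_one hc).2 haβ) (D.one_le_dampingGain x.2.2) (by positivity)
    (D.sq_le_mul_dampingGain x.2.2) (by rw [dampingGain]; field_simp; exact le_rfl)
    (D.assumptionA.μ_pos x.1) (abs_nonneg _) (norm_nonneg (D.S.φ x.1 0))
    (norm_nonneg (D.S.φ x.1 x.2.1 - D.S.φ x.1 0)) hθ (D.assumptionA.growth_w x.1 x.2.1)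
    (by rw [sq_abs]; exact D.assumptionA.growth_y x.1)
  have hφ := inner_mul_le (D.S.φ x.1 x.2.1) (D.S.φ x.1 0) θ (fderiv ℝ D.V x.1 (D.S.g x.1))
  have hA := inner_mul_le (D.S.A x.1 x.2.1) (D.S.A x.1 0) d (fderiv ℝ D.V x.1 (D.S.g x.1))
  refine (add_le_add hφ hA).trans (hest.trans (le_of_eq ?_))
  rw [disturbance, damping]
  ring

lemma fderiv_V_vectorField_le (x : State n l) (v : Vec m × Vec p × Vec q) :
    fderiv ℝ D.V x.1 (D.vectorField (x, v)).1
      ≤ -D.r * D.Q x.1 + D.a * D.β / (D.b + Real.exp x.2.2) * (D.Q x.1 + D.R x.2.1)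
        + D.a * (D.disturbance ‖v.1‖ ‖v.2.1‖ (Real.exp x.2.2) / (D.b + Real.exp x.2.2)) := by
  have hdec := D.assumptionA.decrease_V x.1
  have hcross := D.cross_terms_le x v.1 v.2.1
  have hC : D.dampingGain x.2.2 * D.damping x.1
      ≤ D.C * (D.dampingGain x.2.2 * D.damping x.1) := by
    have ⟨ha, hβ⟩ := And.intro D.a_pos D.β_pos
    have hc := D.b_add_exp_pos x.2.2
    have hμ := D.assumptionA.μ_pos x.1
    refine le_mul_of_one_le_left ?_ D.one_le_C
    unfold dampingGain damping
    positivity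
  rw [fderiv_V_vectorField]
  linarith

lemma div_b_add_exp_le (z : ℝ) : D.a * D.β / (D.b + Real.exp z) ≤ D.a * D.β / D.b :=
  div_le_div_of_nonneg_left (mul_pos D.a_pos D.β_pos).le D.b_pos
    (le_add_of_nonneg_right (Real.exp_pos z).le)

lemma fderiv_U_vectorField_le (x : State n l) (v : Vec m × Vec p × Vec q) :
    fderiv ℝ D.V x.1 (D.vectorField (x, v)).1
        + D.r / 2 * fderiv ℝ D.Φ x.2.1 (D.vectorField (x, v)).2.1
      ≤ -(D.rate * (D.Q x.1 + D.R x.2.1)) + D.χ ‖v.1‖ ‖v.2.2‖ ‖v.2.1‖ (Real.exp x.2.2) := by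
  have hV := D.fderiv_V_vectorField_le x v
  have hΦ := mul_le_mul_of_nonneg_left (D.assumptionA.decrease_Φ x.1 x.2.1 v.2.2)
    (half_pos D.r_pos).le
  have hQR := mul_le_mul_of_nonneg_right (D.div_b_add_exp_le x.2.2)
    (add_nonneg (D.assumptionA.Q_prop.nonneg x.1) (D.assumptionA.R_prop.nonneg x.2.1))
  rw [χ_eq, rate]
  change _ + D.r / 2 * fderiv ℝ D.Φ x.2.1 (D.S.h x.1 x.2.1 v.2.2) ≤ _
  linarith

lemma fderiv_V_vectorField_le_rate (x : State n l) (v : Vec m × Vec p × Vec q) :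
    fderiv ℝ D.V x.1 (D.vectorField (x, v)).1
      ≤ -(D.rate * D.Q x.1)
        + D.a * (D.β * D.R x.2.1 + D.disturbance ‖v.1‖ ‖v.2.1‖ (Real.exp x.2.2))
          / (D.b + Real.exp x.2.2) := by
  have hV := D.fderiv_V_vectorField_le x v
  have hQ := mul_le_mul_of_nonneg_right (D.div_b_add_exp_le x.2.2)
    (D.assumptionA.Q_prop.nonneg x.1)
  have hrQ := mul_nonneg (half_pos D.r_pos).le (D.assumptionA.Q_prop.nonneg x.1)
  rw [rate]
  rw [mul_add (D.a * D.β / _)] at hV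
  refine hV.trans ?_
  rw [mul_add, add_div]
  have hsplit : D.a * D.β / (D.b + Real.exp x.2.2) * D.R x.2.1
      = D.a * (D.β * D.R x.2.1) / (D.b + Real.exp x.2.2) := by ring
  rw [hsplit, mul_div_assoc D.a (D.disturbance _ _ _)]
  linarith

end Dissipation

/-! ### Comparison functions of a design -/

/-- Functions of class `K_∞` comparing the functions of Assumption (A) with each other, and a
positive lower bound `P` for `rate * Q` on `{ε ≤ V}`. -/
structure Comparison where
  σ : ℝ ≃o ℝ
  σR : ℝ ≃o ℝ
  σΦ : ℝ ≃o ℝ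
  σQ : ℝ ≃o ℝ
  P : ℝ
  σ_zero : σ 0 = 0
  σR_zero : σR 0 = 0
  σΦ_zero : σΦ 0 = 0
  σQ_zero : σQ 0 = 0
  U_le : ∀ x : State n l, D.U x ≤ σ (D.rate / 2 * (D.Q x.1 + D.R x.2.1))
  R_le : ∀ w, D.R w ≤ σR (D.Φ w)
  Φ_le : ∀ w, D.Φ w ≤ σΦ (D.R w)
  Q_le : ∀ y, D.Q y ≤ σQ (D.V y)
  P_pos : 0 < P
  P_le : ∀ y, D.ε ≤ D.V y → P ≤ D.rate * D.Q y

lemma exists_orderIso_U_le {κ : ℝ} (hκ : 0 < κ) :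
    ∃ σ : ℝ ≃o ℝ, σ 0 = 0 ∧ ∀ x : State n l, D.U x ≤ σ (κ * (D.Q x.1 + D.R x.2.1)) := by
  have hQ := D.assumptionA.Q_prop
  have hR := D.assumptionA.R_prop
  let W (u : Vec n × Vec l) : ℝ := κ * (D.Q u.1 + D.R u.2)
  have hW : Continuous W := continuous_const.mul
    ((hQ.continuous.comp continuous_fst).add (hR.continuous.comp continuous_snd))
  have hU : Continuous fun u : Vec n × Vec l => D.U (u.1, u.2, 0) :=
    D.contDiff_U.continuous.comp (by fun_prop)
  have hcpt : ∀ M, 0 < M → IsCompact {u | W u ≤ M} := fun M hM => by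
    refine ((hQ.radiallyUnbounded (M / κ) (by positivity)).prod
      (hR.radiallyUnbounded (M / κ) (by positivity))).of_isClosed_subset
      (isClosed_le hW continuous_const) fun u hu => ?_
    have hsum : D.Q u.1 + D.R u.2 ≤ M / κ := (le_div_iff₀' hκ).2 hu
    exact ⟨(le_add_of_nonneg_right (hR.nonneg u.2)).trans hsum,
      (le_add_of_nonneg_left (hQ.nonneg u.1)).trans hsum⟩
  have hzero : ∀ u, W u = 0 → D.U (u.1, u.2, 0) = 0 := fun u hu => by
    obtain ⟨hQu, hRu⟩ := (add_eq_zero_iff_of_nonneg (hQ.nonneg u.1) (hR.nonneg u.2)).1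
      ((mul_eq_zero_iff_left hκ.ne').1 hu)
    simp only [U, lyapU, hQ.eq_zero hQu, hR.eq_zero hRu, D.assumptionA.V_prop.map_zero,
      D.assumptionA.Φ_prop.map_zero, mul_zero, add_zero]
  obtain ⟨σ, hσ0, hσ⟩ := exists_orderIso_dominating hW hU hcpt
    (fun u => mul_nonneg hκ.le (add_nonneg (hQ.nonneg u.1) (hR.nonneg u.2)))
    (fun u => D.U_nonneg _) hzero
  exact ⟨σ, hσ0, fun x => hσ (x.1, x.2.1)⟩

lemma nonempty_comparison : Nonempty D.Comparison := by
  obtain ⟨hV, hQ, hΦ, hR⟩ := And.intro D.assumptionA.V_prop <| And.intro D.assumptionA.Q_prop <|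
    And.intro D.assumptionA.Φ_prop D.assumptionA.R_prop
  obtain ⟨σ, hσ0, hσ⟩ := D.exists_orderIso_U_le (half_pos D.rate_pos)
  obtain ⟨σR, hσR0, hσR⟩ := hΦ.exists_orderIso_dominating hR.continuous hR.map_zero hR.nonneg
  obtain ⟨σΦ, hσΦ0, hσΦ⟩ := hR.exists_orderIso_dominating hΦ.continuous hΦ.map_zero hΦ.nonneg
  obtain ⟨σQ, hσQ0, hσQ⟩ := hV.exists_orderIso_dominating hQ.continuous hQ.map_zero hQ.nonneg
  obtain ⟨σV, hσV0, hσV⟩ := hQ.exists_orderIso_dominating hV.continuous hV.map_zero hV.nonneg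
  have hσVε : 0 < σV.symm D.ε := (orderIso_symm_zero hσV0).symm.trans_lt
    (σV.symm.strictMono D.ε_pos)
  exact ⟨{
    σ := σ, σR := σR, σΦ := σΦ, σQ := σQ, P := D.rate * σV.symm D.ε
    σ_zero := hσ0, σR_zero := hσR0, σΦ_zero := hσΦ0, σQ_zero := hσQ0
    U_le := hσ, R_le := hσR, Φ_le := hσΦ, Q_le := hσQ
    P_pos := mul_pos D.rate_pos hσVε
    P_le := fun y hy => mul_le_mul_of_nonneg_left
      (σV.symm_apply_le.2 (hy.trans (hσV y))) D.rate_pos.le }⟩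

namespace Comparison

variable {D} (c : D.Comparison)

/-- The bound for `U` given by the initial state and the norms of the inputs. The argument of `γ`
is truncated because `γ` need not be continuous on the negative half-line. -/
noncomputable def stateBound (X : State n l × (ℝ × ℝ × ℝ)) : ℝ :=
  decayKL c.σ.symm (D.U X.1) 0
    + c.σ (D.χ X.2.1 (max X.2.2.1 0) X.2.2.2 (Real.exp X.1.2.2))

/-- The bound `M` for the perturbation in `V' ≤ -rate * Q + M / (b + e^z)`. -/
noncomputable def perturbationBound (X : State n l × (ℝ × ℝ × ℝ)) : ℝ :=
  D.a * (D.β * c.σR (2 / D.r * c.stateBound X) + D.disturbance X.2.1 X.2.2.2 0)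

lemma continuous_stateBound : Continuous c.stateBound := by
  have hU : Continuous fun X : State n l × (ℝ × ℝ × ℝ) => D.U X.1 :=
    D.contDiff_U.continuous.comp continuous_fst
  have hχ : Continuous fun X : State n l × (ℝ × ℝ × ℝ) =>
      D.χ X.2.1 (max X.2.2.1 0) X.2.2.2 (Real.exp X.1.2.2) :=
    D.continuous_χ.comp (by fun_prop :
      Continuous fun X : State n l × (ℝ × ℝ × ℝ) => (X.2.1, X.2.2.1, X.2.2.2, X.1.2.2))
  exact ((continuous_decayKL c.σ.symm 0).comp hU).add (c.σ.continuous.comp hχ)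

lemma continuous_perturbationBound : Continuous c.perturbationBound := by
  have hσR : Continuous fun X => c.σR (2 / D.r * c.stateBound X) :=
    c.σR.continuous.comp (continuous_const.mul c.continuous_stateBound)
  have hdist : Continuous fun X : State n l × (ℝ × ℝ × ℝ) => D.disturbance X.2.1 X.2.2.2 0 := by
    unfold disturbance
    fun_prop
  exact continuous_const.mul ((continuous_const.mul hσR).add hdist)

end Comparison

/-- The bound for `e^z` obtained in `exp_le_gainBound` from an upper bound for `gainLyap`, where
`E₀ = e^{z₀}` and `p₀ = max (V y₀ - ε) 0 ^ 2 / 2`. -/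
noncomputable def gainBound (P M E₀ p₀ : ℝ) : ℝ :=
  2 * E₀ + D.b + 2 / P * (2 * M ^ 2 / P + D.Γ * p₀)

/-- The part of `gainLyap` that depends on the gain `z` only. -/
noncomputable def gainPotential (P M z : ℝ) : ℝ :=
  P / D.Γ * Real.exp z - M / D.Γ * Real.log (D.b + Real.exp z)

/-- The function whose decrease along solutions bounds the gain `z`. -/
noncomputable def gainLyap (P M : ℝ) (x : State n l) : ℝ :=
  max (D.V x.1 - D.ε) 0 ^ 2 / 2 + D.gainPotential P M x.2.2

section GainLyap

variable {P M : ℝ}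

lemma contDiff_gainPotential (P M : ℝ) : ContDiff ℝ ∞ (D.gainPotential P M) := by
  have hlog : ContDiff ℝ ∞ fun z => Real.log (D.b + Real.exp z) :=
    ContDiff.log (by fun_prop) fun z => (D.b_add_exp_pos z).ne'
  unfold gainPotential
  fun_prop

lemma locallyLipschitz_gainLyap (P M : ℝ) : LocallyLipschitz (D.gainLyap P M) := by
  let F (u : ℝ × ℝ) : ℝ := u.1 ^ 2 / 2 + D.gainPotential P M u.2
  have hF : ContDiff ℝ ∞ F :=
    ((contDiff_fst.pow 2).div_const 2).add ((D.contDiff_gainPotential P M).comp contDiff_snd)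
  have hu : LocallyLipschitz fun x : State n l => (max (D.V x.1 - D.ε) 0, x.2.2) :=
    D.locallyLipschitz_excess.prodMk
      (LipschitzWith.prod_snd.comp LipschitzWith.prod_snd).locallyLipschitz
  have hcomp : D.gainLyap P M = F ∘ fun x => (max (D.V x.1 - D.ε) 0, x.2.2) := rfl
  rw [hcomp]
  exact (hF.of_le (by simp)).locallyLipschitz.comp hu

lemma mul_log_b_add_le (hP : 0 < P) {E : ℝ} (hE : 0 < E) (hM : 0 ≤ M) :
    M * Real.log (D.b + E) ≤ P / 2 * (D.b + E) + 2 * M ^ 2 / P := by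
  have hpos : 0 < D.b + E := add_pos D.b_pos hE
  have hlog : Real.log (D.b + E) ≤ 2 * √(D.b + E) := by
    have hle := Real.log_le_sub_one_of_pos (Real.sqrt_pos.2 hpos)
    rw [Real.log_sqrt hpos.le] at hle
    linarith
  refine (mul_le_mul_of_nonneg_left hlog hM).trans
    (le_add_of_sq_le_four_mul (by positivity) (by positivity) (le_of_eq ?_))
  rw [mul_pow, mul_pow, Real.sq_sqrt hpos.le]
  field_simp
  ring

lemma exp_le_gainBound (hP : 0 < P) (hM : 0 ≤ M) {z z₀ p p₀ : ℝ} (hp : 0 ≤ p)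
    (h : p + D.gainPotential P M z ≤ p₀ + D.gainPotential P M z₀) :
    Real.exp z ≤ D.gainBound P M (Real.exp z₀) p₀ := by
  have hΓ := D.Γ_pos
  have hscale : ∀ s y : ℝ, D.Γ * (s + D.gainPotential P M y)
      = D.Γ * s + (P * Real.exp y - M * Real.log (D.b + Real.exp y)) := fun s y => by
    rw [gainPotential]
    field_simp
  have hdecr := mul_le_mul_of_nonneg_left h hΓ.le
  rw [hscale, hscale] at hdecr
  have hp' := mul_nonneg hΓ.le hp
  have hlog₀ := mul_nonneg hM (Real.log_nonneg (D.one_le_b_add_exp z₀))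
  have hlog := D.mul_log_b_add_le hP (Real.exp_pos z) hM
  have hbound : P / 2 * D.gainBound P M (Real.exp z₀) p₀
      = P * Real.exp z₀ + P / 2 * D.b + (2 * M ^ 2 / P + D.Γ * p₀) := by
    rw [gainBound]
    field_simp
  refine le_of_mul_le_mul_left ?_ (half_pos hP)
  linarith

lemma gainBound_pos (hP : 0 < P) {E₀ p₀ : ℝ} (hE₀ : 0 < E₀) (hp₀ : 0 ≤ p₀) (M : ℝ) :
    0 < D.gainBound P M E₀ p₀ := by
  have ⟨hb, hΓ⟩ := And.intro D.b_pos D.Γ_pos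
  unfold gainBound
  positivity

lemma hasDerivAt_exp_gain {x : ℝ → State n l} {v : Vec m × Vec p × Vec q} {s : ℝ}
    (h : HasDerivAt x (D.vectorField (x s, v)) s) :
    HasDerivAt (fun t => Real.exp (x t).2.2) (D.Γ * max (D.V (x s).1 - D.ε) 0) s := by
  refine (hasDerivAt_snd (hasDerivAt_snd h)).exp.congr_deriv ?_
  simp only [vectorField, closedLoop, Real.exp_neg]
  field_simp

lemma hasDerivAt_gainLyap {x : ℝ → State n l} {v : Vec m × Vec p × Vec q} {s : ℝ}
    (h : HasDerivAt x (D.vectorField (x s, v)) s) :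
    HasDerivAt (fun t => D.gainLyap P M (x t)) (max (D.V (x s).1 - D.ε) 0
      * (fderiv ℝ D.V (x s).1 (D.vectorField (x s, v)).1 + P
        - M / (D.b + Real.exp (x s).2.2))) s := by
  have ⟨hΓ, hb⟩ := And.intro D.Γ_pos (D.b_add_exp_pos (x s).2.2)
  have hV := (D.assumptionA.V_prop.hasDerivAt_comp (hasDerivAt_fst h)).sub_const D.ε
  have hE := D.hasDerivAt_exp_gain h
  have hlog := (hE.const_add D.b).log hb.ne'
  refine (((hasDerivAt_max_sq_div_two _).comp s hV).add
    ((hE.const_mul (P / D.Γ)).sub (hlog.const_mul (M / D.Γ)))).congr_deriv ?_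
  field_simp
  ring

lemma max_mul_fderiv_V_vectorField_nonpos (hP : ∀ y, D.ε ≤ D.V y → P ≤ D.rate * D.Q y)
    (x : State n l) (v : Vec m × Vec p × Vec q)
    (hM : D.a * (D.β * D.R x.2.1 + D.disturbance ‖v.1‖ ‖v.2.1‖ 0) ≤ M) :
    max (D.V x.1 - D.ε) 0 * (fderiv ℝ D.V x.1 (D.vectorField (x, v)).1 + P
      - M / (D.b + Real.exp x.2.2)) ≤ 0 := by
  rcases le_total (D.V x.1 - D.ε) 0 with hV | hV
  · rw [max_eq_right hV, zero_mul]
  refine mul_nonpos_of_nonneg_of_nonpos (le_max_right _ _) ?_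
  have hPQ := hP x.1 (sub_nonneg.1 hV)
  have hdist := D.disturbance_mono (norm_nonneg v.1) le_rfl (le_refl ‖v.2.1‖)
    (Real.exp_pos x.2.2).le
  have hpert : D.a * (D.β * D.R x.2.1 + D.disturbance ‖v.1‖ ‖v.2.1‖ (Real.exp x.2.2))
      / (D.b + Real.exp x.2.2) ≤ M / (D.b + Real.exp x.2.2) :=
    div_le_div_of_nonneg_right ((mul_le_mul_of_nonneg_left (add_le_add_right hdist _)
      D.a_pos.le).trans hM) (D.b_add_exp_pos _).le
  linarith [D.fderiv_V_vectorField_le_rate x v]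

end GainLyap

/-- The bound for the limit of the gain `z`. -/
noncomputable def Comparison.gainLimitBound {D : Design n l m p q} (c : D.Comparison)
    (X : State n l × (ℝ × ℝ × ℝ)) : ℝ :=
  Real.log (D.gainBound c.P (c.perturbationBound X) (Real.exp X.1.2.2)
    (max (D.V X.1.1 - D.ε) 0 ^ 2 / 2))

lemma Comparison.continuous_gainLimitBound {D : Design n l m p q} (c : D.Comparison) :
    Continuous c.gainLimitBound := by
  have hM := c.continuous_perturbationBound
  have hp : Continuous fun X : State n l × (ℝ × ℝ × ℝ) => max (D.V X.1.1 - D.ε) 0 ^ 2 / 2 :=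
    ((D.locallyLipschitz_excess.continuous.comp continuous_fst).pow 2).div_const 2
  refine Continuous.log ?_ fun X =>
    (D.gainBound_pos c.P_pos (Real.exp_pos _) (by positivity) _).ne'
  unfold gainBound
  have hE : Continuous fun X : State n l × (ℝ × ℝ × ℝ) => 2 * Real.exp X.1.2.2 + D.b := by fun_prop
  exact hE.add (continuous_const.mul
    (((continuous_const.mul (hM.pow 2)).div_const _).add (continuous_const.mul hp)))

end Design

/-! ### A priori bounds -/

section AprioriBounds

variable {D : Design n l m p q} {I : Inputs m p q} {x₀ : State n l} {T : ℝ} {x : ℝ → State n l}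

namespace Design

namespace IsSolution

lemma restrict_Icc (hx : D.IsSolution I x₀ (Ici 0) x) (T : ℝ) : D.IsSolution I x₀ (Icc 0 T) x :=
  hx.mono Icc_subset_Ici_self

lemma hasDerivLEOn (hx : D.IsSolution I x₀ (Icc 0 T) x) (hT : 0 ≤ T) {W : State n l → ℝ}
    (hW : LocallyLipschitz W) {g : ℝ → ℝ}
    (h : ∀ᵐ s, s ∈ Ioo 0 T → HasDerivAt x (D.vectorField (x s, I.eval s)) s →
      deriv (fun t => W (x t)) s ≤ g s) :
    HasDerivLEOn (fun t => W (x t)) g 0 T :=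
  hx.hasDerivLEOn_comp (D.isCaratheodoryField I) hT hW h

lemma hasDerivLEOn_neg_exp_gain (hx : D.IsSolution I x₀ (Icc 0 T) x) (hT : 0 ≤ T) :
    HasDerivLEOn (fun t => -Real.exp (x t).2.2) (fun s => -(D.Γ * max (D.V (x s).1 - D.ε) 0))
      0 T := by
  have hW : ContDiff ℝ 1 fun x : State n l => -Real.exp x.2.2 := by fun_prop
  exact hx.hasDerivLEOn hT hW.locallyLipschitz
    (.of_forall fun s _ h => (D.hasDerivAt_exp_gain h).fun_neg.deriv.le)

lemma hasDerivLEOn_Φ (hx : D.IsSolution I x₀ (Icc 0 T) x) (hT : 0 ≤ T) :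
    HasDerivLEOn (fun t => D.Φ (x t).2.1)
      (fun s => -D.R (x s).2.1 + D.γ ‖I.δ s‖ + D.Q (x s).1) 0 T := by
  have hW : LocallyLipschitz fun x : State n l => D.Φ x.2.1 :=
    D.assumptionA.Φ_prop.locallyLipschitz.comp
      (LipschitzWith.prod_fst.comp LipschitzWith.prod_snd).locallyLipschitz
  refine hx.hasDerivLEOn hT hW (.of_forall fun s _ h => ?_)
  exact (D.assumptionA.Φ_prop.hasDerivAt_comp (hasDerivAt_fst (hasDerivAt_snd h))).deriv.trans_le
    (D.assumptionA.decrease_Φ _ _ _)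

lemma hasDerivLEOn_U (hx : D.IsSolution I x₀ (Icc 0 T) x) (hT : 0 ≤ T) :
    HasDerivLEOn (fun t => D.U (x t)) (fun s => -(D.rate * (D.Q (x s).1 + D.R (x s).2.1))
      + D.χ ‖I.d s‖ ‖I.δ s‖ ‖I.θ s‖ (Real.exp (x s).2.2)) 0 T := by
  refine hx.hasDerivLEOn hT (D.contDiff_U.of_le (by simp)).locallyLipschitz
    (.of_forall fun s _ h => ?_)
  have hV := D.assumptionA.V_prop.hasDerivAt_comp (hasDerivAt_fst h)
  have hΦ := D.assumptionA.Φ_prop.hasDerivAt_comp (hasDerivAt_fst (hasDerivAt_snd h))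
  exact (hV.fun_add (hΦ.const_mul (D.r / 2))).deriv.trans_le
    (D.fderiv_U_vectorField_le (x s) (I.eval s))

lemma monotoneOn_gain (hx : D.IsSolution I x₀ (Icc 0 T) x) :
    MonotoneOn (fun t => (x t).2.2) (Icc 0 T) := by
  rcases lt_or_ge T 0 with hT | hT
  · simp only [Icc_eq_empty_of_lt hT, MonotoneOn, mem_empty_iff_false, false_imp_iff, implies_true]
  have hanti := (hx.hasDerivLEOn_neg_exp_gain hT).antitoneOn (.of_forall fun s _ =>
    neg_nonpos.2 (mul_nonneg D.Γ_pos.le (le_max_right _ _)))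
  exact fun s hs t ht hst => Real.exp_le_exp.1 (neg_le_neg_iff.1 (hanti hs ht hst))

lemma le_gain (hx : D.IsSolution I x₀ (Icc 0 T) x) {t : ℝ} (ht : t ∈ Icc 0 T) :
    x₀.2.2 ≤ (x t).2.2 := by
  have h0 : (0 : ℝ) ∈ Icc 0 T := ⟨le_rfl, ht.1.trans ht.2⟩
  simpa only [hx.apply_zero h0] using hx.monotoneOn_gain h0 ht ht.1

end IsSolution

lemma Comparison.neg_rate_mul_add_le (c : D.Comparison) {x : State n l} {χ₀ : ℝ}
    (h : χ₀ ≤ c.σ.symm (D.U x)) :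
    -(D.rate * (D.Q x.1 + D.R x.2.1)) + χ₀ ≤ -c.σ.symm (D.U x) := by
  have hU := c.σ.symm_apply_le.2 (c.U_le x)
  linarith

namespace IsSolution

lemma U_le (hx : D.IsSolution I x₀ (Icc 0 T) x) (c : D.Comparison) (hT : 0 ≤ T) :
    D.U (x T) ≤ decayKL c.σ.symm (D.U x₀) T
      + c.σ (D.χ (supNorm I.d) (supNorm I.δ) (supNorm I.θ) (Real.exp x₀.2.2)) := by
  have hσ := orderIso_symm_zero c.σ_zero
  set χ₀ := D.χ (supNorm I.d) (supNorm I.δ) (supNorm I.θ) (Real.exp x₀.2.2)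
  have hχ₀_nonneg : 0 ≤ χ₀ := D.χ_nonneg (supNorm_nonneg _) (Real.exp_pos _).le _ _
  rcases le_or_gt (D.U (x T)) (c.σ χ₀) with hle | hlt
  · exact hle.trans (le_add_of_nonneg_left (decayKL_nonneg hσ (D.U_nonneg _) hT))
  have hχ : ∀ᵐ s, s ∈ Ioo 0 T → D.χ ‖I.d s‖ ‖I.δ s‖ ‖I.θ s‖ (Real.exp (x s).2.2) ≤ χ₀ := by
    filter_upwards [I.ae_norm_le] with s hs hsT
    obtain ⟨hd, hθ, hδ⟩ := hs hsT.1.le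
    exact D.χ_mono (norm_nonneg _) (norm_nonneg _) (Real.exp_pos _).le hd hδ hθ
      (Real.exp_le_exp.2 (hx.le_gain (Ioo_subset_Icc_self hsT)))
  have hdecay := (hx.hasDerivLEOn_U hT).decay_of_lt hT c.σ.symm.monotone
    (by rwa [c.σ.symm_apply_apply]) (hχ.mono fun s hs hsT hlt =>
      (add_le_add_right (hs hsT) _).trans (c.neg_rate_mul_add_le (c.σ.lt_symm_apply.2 hlt).le)) hlt
  rw [sub_zero, hx.apply_zero ⟨le_rfl, hT⟩] at hdecay
  exact (le_decayKL hσ (D.U_nonneg _) hT hdecay).trans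
    (le_add_of_nonneg_right (orderIso_nonneg c.σ_zero hχ₀_nonneg))

lemma U_le_stateBound (hx : D.IsSolution I x₀ (Icc 0 T) x) (c : D.Comparison) (hT : 0 ≤ T) :
    D.U (x T) ≤ c.stateBound (x₀, I.norms) := by
  have hdecay := (isClassKL_decayKL (orderIso_symm_zero c.σ_zero)).antitoneOn (D.U x₀)
    (D.U_nonneg x₀) self_mem_Ici hT hT
  simpa only [Comparison.stateBound, Inputs.norms, max_eq_left (supNorm_nonneg _)] using
    (hx.U_le c hT).trans (add_le_add_left hdecay _)

lemma R_le (hx : D.IsSolution I x₀ (Icc 0 T) x) (c : D.Comparison) (hT : 0 ≤ T) :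
    D.R (x T).2.1 ≤ c.σR (2 / D.r * c.stateBound (x₀, I.norms)) :=
  (c.R_le _).trans (c.σR.monotone ((D.Φ_le_U _).trans
    (mul_le_mul_of_nonneg_left (hx.U_le_stateBound c hT) (div_pos two_pos D.r_pos).le)))

lemma perturbationBound_nonneg (hx : D.IsSolution I x₀ (Icc 0 T) x) (c : D.Comparison)
    (hT : 0 ≤ T) : 0 ≤ c.perturbationBound (x₀, I.norms) :=
  mul_nonneg D.a_pos.le (add_nonneg
    (mul_nonneg D.β_pos.le ((D.assumptionA.R_prop.nonneg _).trans (hx.R_le c hT)))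
    (D.disturbance_nonneg _ _ _))

lemma antitoneOn_gainLyap (hx : D.IsSolution I x₀ (Icc 0 T) x) (c : D.Comparison) :
    AntitoneOn (fun t => D.gainLyap c.P (c.perturbationBound (x₀, I.norms)) (x t))
      (Icc 0 T) := by
  rcases lt_or_ge T 0 with hT | hT
  · simp only [Icc_eq_empty_of_lt hT, AntitoneOn, mem_empty_iff_false, false_imp_iff, implies_true]
  refine (hx.hasDerivLEOn hT (D.locallyLipschitz_gainLyap _ _) (g := fun _ => 0) ?_).antitoneOn
    (.of_forall fun _ _ => le_rfl)
  filter_upwards [I.ae_norm_le] with s hs hsT h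
  obtain ⟨hd, hθ, -⟩ := hs hsT.1.le
  have hR := R_le (hx.mono (Icc_subset_Icc_right hsT.2.le)) c hsT.1.le
  refine (D.hasDerivAt_gainLyap h).deriv.trans_le
    (D.max_mul_fderiv_V_vectorField_nonpos c.P_le _ _ ?_)
  exact mul_le_mul_of_nonneg_left (add_le_add (mul_le_mul_of_nonneg_left hR D.β_pos.le)
    (D.disturbance_mono (norm_nonneg _) hd hθ le_rfl)) D.a_pos.le

lemma gain_le (hx : D.IsSolution I x₀ (Icc 0 T) x) (c : D.Comparison) (hT : 0 ≤ T) :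
    (x T).2.2 ≤ c.gainLimitBound (x₀, I.norms) := by
  have hanti := hx.antitoneOn_gainLyap c ⟨le_rfl, hT⟩ ⟨hT, le_rfl⟩ hT
  simp only [gainLyap, hx.apply_zero ⟨le_rfl, hT⟩] at hanti
  rw [Comparison.gainLimitBound, Real.le_log_iff_exp_le
    (D.gainBound_pos c.P_pos (Real.exp_pos _) (by positivity) _)]
  exact D.exp_le_gainBound c.P_pos (hx.perturbationBound_nonneg c hT) (by positivity) hanti

lemma eqOn_Ico {y : ℝ → State n l} (hx : D.IsSolution I x₀ (Ico 0 T) x)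
    (hy : D.IsSolution I x₀ (Ici 0) y) : EqOn x y (Ico 0 T) := fun t ht =>
  (hx.mono (Icc_subset_Ico_right ht.2)).eqOn_Icc (D.isCaratheodoryField I)
    (hy.restrict_Icc t) ⟨ht.1, le_rfl⟩

end IsSolution

lemma isCompact_U_le_and_gain_mem_Icc (D : Design n l m p q) {K : ℝ} (hK : 0 < K) (z₀ z₁ : ℝ) :
    IsCompact {x : State n l | D.U x ≤ K ∧ x.2.2 ∈ Icc z₀ z₁} := by
  have hU := D.contDiff_U.continuous
  refine ((D.assumptionA.V_prop.radiallyUnbounded K hK).prod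
    ((D.assumptionA.Φ_prop.radiallyUnbounded (2 / D.r * K)
      (mul_pos (div_pos two_pos D.r_pos) hK)).prod
        (isCompact_Icc (a := z₀) (b := z₁)))).of_isClosed_subset
    ((isClosed_le hU continuous_const).inter (isClosed_Icc.preimage (by fun_prop))) ?_
  exact fun x hx => ⟨(D.V_le_U x).trans hx.1, (D.Φ_le_U x).trans
    (mul_le_mul_of_nonneg_left hx.1 (div_pos two_pos D.r_pos).le), hx.2⟩

lemma exists_isSolution (c : D.Comparison) (I : Inputs m p q) (x₀ : State n l) :
    ∃ x, D.IsSolution I x₀ (Ici 0) x := by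
  set X := (x₀, I.norms)
  obtain ⟨ρ, hρ⟩ := (D.isCompact_U_le_and_gain_mem_Icc (lt_max_of_lt_right one_pos)
    x₀.2.2 (c.gainLimitBound X) (K := max (c.stateBound X) 1)).isBounded.exists_norm_le
  refine (D.isCaratheodoryField I).exists_solution_of_apriori_bound (ρ := ρ + 1)
    fun T x hT hx => (hρ _ ⟨?_, ?_, ?_⟩).trans_lt (lt_add_one ρ)
  · exact (IsSolution.U_le_stateBound hx c hT).trans (le_max_left _ _)
  · exact IsSolution.le_gain hx ⟨hT, le_rfl⟩
  · exact IsSolution.gain_le hx c hT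

end Design

end AprioriBounds

/-! ### Asymptotics -/

lemma exists_tendsto_of_monotoneOn_Ici {v : ℝ → ℝ} {a B : ℝ} (hv : MonotoneOn v (Ici a))
    (hB : ∀ t, a ≤ t → v t ≤ B) :
    ∃ L ≤ B, Tendsto v atTop (𝓝 L) ∧ ∀ t, a ≤ t → v t ≤ L := by
  have hmono : Monotone fun t => v (max t a) := fun s t hst =>
    hv (mem_Ici.2 (le_max_right _ _)) (mem_Ici.2 (le_max_right _ _)) (max_le_max_right a hst)
  have hbdd : BddAbove (range fun t => v (max t a)) :=
    ⟨B, forall_mem_range.2 fun t => hB _ (le_max_right _ _)⟩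
  refine ⟨_, ciSup_le fun t => hB _ (le_max_right _ _), (tendsto_atTop_ciSup hmono hbdd).congr' ?_,
    fun t ht => ?_⟩
  · filter_upwards [eventually_ge_atTop a] with t ht
    rw [max_eq_left ht]
  · simpa only [max_eq_left ht] using le_ciSup hbdd t

lemma isBoundedUnder_and_limsup_le {v : ℝ → ℝ} {c : ℝ} (hv : ∀ t, 0 ≤ v t)
    (h : ∀ η, 0 < η → ∀ᶠ t in atTop, v t ≤ c + η) :
    IsBoundedUnder (· ≤ ·) atTop v ∧ limsup v atTop ≤ c :=
  ⟨⟨c + 1, eventually_map.2 (h 1 one_pos)⟩, le_of_forall_pos_le_add fun η hη =>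
    limsup_le_of_le (isCoboundedUnder_le_of_le atTop hv) (h η hη)⟩

lemma eventually_essAtTop_iff {P : ℝ → Prop} :
    (∀ᶠ t in essAtTop, P t) ↔ ∃ T₀, 0 ≤ T₀ ∧ ∀ᵐ t, T₀ < t → P t := by
  constructor
  · intro h
    obtain ⟨s, hs, u, hu, hsu⟩ := eventually_inf.1 h
    obtain ⟨N, hN⟩ := mem_atTop_sets.1 hs
    refine ⟨max N 0, le_max_right _ _, ?_⟩
    filter_upwards [hu] with t ht hlt using hsu t ⟨hN t ((le_max_left _ _).trans hlt.le), ht⟩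
  · rintro ⟨T₀, -, h⟩
    filter_upwards [mem_inf_of_left (Ioi_mem_atTop T₀), mem_inf_of_right h] with t ht ht'
      using ht' ht

lemma eventually_essAtTop_of_ae {P : ℝ → Prop} (h : ∀ᵐ t, 0 ≤ t → P t) :
    ∀ᶠ t in essAtTop, P t :=
  eventually_essAtTop_iff.2 ⟨0, le_rfl, h.mono fun _ ht hlt => ht hlt.le⟩

instance neBot_essAtTop : NeBot essAtTop := by
  refine inf_neBot_iff_frequently_left.2 fun {P} hP => frequently_ae_iff.2 fun h0 => ?_
  obtain ⟨N, hN⟩ := eventually_atTop.1 hP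
  have hIci : volume (Ici N) = 0 := measure_mono_null hN h0
  simp only [Real.volume_Ici, ENNReal.top_ne_zero] at hIci

lemma IsLInfty.isBoundedUnder_norm {j : ℕ} {d : ℝ → Vec j} (hd : IsLInfty d) :
    IsBoundedUnder (· ≤ ·) essAtTop fun t => ‖d t‖ :=
  ⟨supNorm d, eventually_map.2 (eventually_essAtTop_of_ae hd.ae_norm_le)⟩

lemma IsLInfty.limsup_norm_nonneg {j : ℕ} {d : ℝ → Vec j} (hd : IsLInfty d) :
    0 ≤ limsup (fun t => ‖d t‖) essAtTop :=
  le_limsup_of_le hd.isBoundedUnder_norm fun _ hc =>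
    let ⟨_, ht⟩ := hc.exists
    (norm_nonneg _).trans ht

section Asymptotics

variable {D : Design n l m p q} {I : Inputs m p q} {x₀ : State n l} {x : ℝ → State n l}

namespace Design

/-- The gain from `ε + limsup |δ|` to `limsup Φ`. -/
noncomputable def Comparison.asymptoticGain (c : D.Comparison) (s : ℝ) : ℝ :=
  c.σΦ (D.γ s + c.σQ (2 * s) + s)

lemma Comparison.isGainFunction_asymptoticGain (c : D.Comparison) :
    IsGainFunction c.asymptoticGain where
  continuousOn := c.σΦ.continuous.comp_continuousOn ((D.assumptionA.γ_prop.continuousOn.add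
    (c.σQ.continuous.comp (continuous_const_mul 2)).continuousOn).add continuousOn_id)
  monotoneOn _ hs _ ht hst := c.σΦ.monotone (add_le_add (add_le_add
    (D.assumptionA.γ_prop.monotoneOn hs ht hst)
    (c.σQ.monotone (mul_le_mul_of_nonneg_left hst zero_le_two))) hst)
  nonneg s hs := orderIso_nonneg c.σΦ_zero (add_nonneg (add_nonneg
    (D.assumptionA.γ_prop.nonneg s hs)
    (orderIso_nonneg c.σQ_zero (mul_nonneg zero_le_two hs))) hs)

lemma Comparison.asymptoticGain_zero (c : D.Comparison) (hγ : D.γ 0 = 0) :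
    c.asymptoticGain 0 = 0 := by
  simp only [asymptoticGain, hγ, mul_zero, c.σQ_zero, add_zero, c.σΦ_zero]

lemma χ_eq_zero (hγ : D.γ 0 = 0) (hΛ : D.Λ = 0) {s₃ s₄ : ℝ} (h : s₃ - D.b ≤ s₄) :
    D.χ 0 0 s₃ s₄ = 0 := by
  simp only [χ_eq, disturbance, hγ, hΛ, max_eq_right (sub_nonpos.2 h)]
  ring

namespace IsSolution

lemma monotoneOn_gain_Ici (hx : D.IsSolution I x₀ (Ici 0) x) :
    MonotoneOn (fun t => (x t).2.2) (Ici 0) := fun _ hs t _ hst =>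
  (hx.restrict_Icc t).monotoneOn_gain ⟨hs, hst⟩ ⟨hs.trans hst, le_rfl⟩ hst

lemma exists_tendsto_gain (hx : D.IsSolution I x₀ (Ici 0) x) (c : D.Comparison) :
    ∃ zlim ≤ c.gainLimitBound (x₀, I.norms), Tendsto (fun t => (x t).2.2) atTop (𝓝 zlim) ∧
      ∀ t, 0 ≤ t → (x t).2.2 ≤ zlim :=
  exists_tendsto_of_monotoneOn_Ici hx.monotoneOn_gain_Ici fun t ht =>
    (hx.restrict_Icc t).gain_le c ht

lemma exists_tendsto_excess (hx : D.IsSolution I x₀ (Ici 0) x) (c : D.Comparison) :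
    ∃ e, Tendsto (fun t => max (D.V (x t).1 - D.ε) 0) atTop (𝓝 e) := by
  obtain ⟨zlim, -, hz, hzle⟩ := hx.exists_tendsto_gain c
  let M := c.perturbationBound (x₀, I.norms)
  have hpot := (D.contDiff_gainPotential c.P M).continuous
  obtain ⟨K, hK⟩ := (isCompact_Icc (a := x₀.2.2) (b := zlim)).exists_bound_of_continuousOn
    hpot.continuousOn
  have hmono : MonotoneOn (fun t => -D.gainLyap c.P M (x t)) (Ici 0) := fun s hs t _ hst =>
    neg_le_neg ((hx.restrict_Icc t).antitoneOn_gainLyap c ⟨hs, hst⟩ ⟨hs.trans hst, le_rfl⟩ hst)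
  have hbound : ∀ t, 0 ≤ t → -D.gainLyap c.P M (x t) ≤ K := fun t ht => by
    have hpotK := neg_le_of_abs_le
      (hK (x t).2.2 ⟨(hx.restrict_Icc t).le_gain ⟨ht, le_rfl⟩, hzle t ht⟩)
    have hsq : 0 ≤ max (D.V (x t).1 - D.ε) 0 ^ 2 / 2 := by positivity
    rw [gainLyap]
    linarith
  obtain ⟨N, -, hN, -⟩ := exists_tendsto_of_monotoneOn_Ici hmono hbound
  refine ⟨√(2 * (-N - D.gainPotential c.P M zlim)),
    (((hN.neg.sub ((hpot.tendsto zlim).comp hz)).const_mul 2).sqrt).congr fun t => ?_⟩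
  rw [← Real.sqrt_sq (le_max_right (D.V (x t).1 - D.ε) 0)]
  congr 1
  simp only [gainLyap, Function.comp_apply]
  ring

lemma tendsto_excess (hx : D.IsSolution I x₀ (Ici 0) x) (c : D.Comparison) :
    Tendsto (fun t => max (D.V (x t).1 - D.ε) 0) atTop (𝓝 0) := by
  obtain ⟨e, he⟩ := hx.exists_tendsto_excess c
  suffices he0 : e ≤ 0 by
    rwa [he0.antisymm (ge_of_tendsto' he fun t => le_max_right _ _)] at he
  by_contra! hpos
  obtain ⟨zlim, -, -, hzle⟩ := hx.exists_tendsto_gain c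
  obtain ⟨T₀, hT₀⟩ := eventually_atTop.1 (he.eventually_const_le (half_lt_self hpos))
  -- An excess bounded away from zero would push `e^z` beyond every bound.
  have hgrowth := HasDerivLEOn.eventually_le (l := -Real.exp zlim - 1) (c := -Real.exp zlim)
    (η := D.Γ * (e / 2)) (T₀ := max T₀ 0)
    (fun T hT => (hx.restrict_Icc T).hasDerivLEOn_neg_exp_gain hT)
    (fun t ht => neg_le_neg (Real.exp_le_exp.2 (hzle t ht)))
    (mul_pos D.Γ_pos (half_pos hpos)) (le_max_right _ _)
    (.of_forall fun s hs _ => neg_le_neg (mul_le_mul_of_nonneg_left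
      (hT₀ s ((le_max_left _ _).trans hs.le)) D.Γ_pos.le))
  obtain ⟨t, ht, ht0⟩ := (hgrowth.and (eventually_ge_atTop 0)).exists
  linarith [Real.exp_le_exp.2 (hzle t ht0)]

lemma eventually_V_le (hx : D.IsSolution I x₀ (Ici 0) x) (c : D.Comparison) {η : ℝ}
    (hη : 0 < η) : ∀ᶠ t in atTop, D.V (x t).1 ≤ D.ε + η := by
  filter_upwards [(hx.tendsto_excess c).eventually_le_const hη] with t ht
  linarith [le_max_left (D.V (x t).1 - D.ε) 0]

lemma eventually_Φ_le (hx : D.IsSolution I x₀ (Ici 0) x) (c : D.Comparison) :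
    ∀ᶠ t in atTop,
      D.Φ (x t).2.1 ≤ c.asymptoticGain (D.ε + limsup (fun t => ‖I.δ t‖) essAtTop) := by
  set L := limsup (fun t => ‖I.δ t‖) essAtTop
  have hL : 0 ≤ L := I.isLInfty_δ.limsup_norm_nonneg
  have hεL : 0 < D.ε + L := add_pos_of_pos_of_nonneg D.ε_pos hL
  obtain ⟨T₁, hT₁, hδ⟩ := eventually_essAtTop_iff.1
    (eventually_lt_of_limsup_lt (lt_add_of_pos_left L D.ε_pos) I.isLInfty_δ.isBoundedUnder_norm)
  obtain ⟨T₂, hV⟩ := eventually_atTop.1 (hx.eventually_V_le c D.ε_pos)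
  refine HasDerivLEOn.eventually_le (η := D.ε + L) (T₀ := max T₁ T₂)
    (fun T hT => (hx.restrict_Icc T).hasDerivLEOn_Φ hT)
    (fun t _ => D.assumptionA.Φ_prop.nonneg _) hεL (hT₁.trans (le_max_left _ _)) ?_
  filter_upwards [hδ] with s hδs hs hΦ
  have hγ : D.γ ‖I.δ s‖ ≤ D.γ (D.ε + L) := D.assumptionA.γ_prop.monotoneOn
    (norm_nonneg _) hεL.le (hδs ((le_max_left _ _).trans_lt hs)).le
  have hQ : D.Q (x s).1 ≤ c.σQ (2 * (D.ε + L)) := (c.Q_le _).trans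
    (c.σQ.monotone (by linarith [hV s ((le_max_right _ _).trans hs.le)]))
  have hR : D.γ (D.ε + L) + c.σQ (2 * (D.ε + L)) + (D.ε + L) < D.R (x s).2.1 :=
    c.σΦ.lt_iff_lt.1 (hΦ.trans_le (c.Φ_le _))
  linarith

lemma isBoundedUnder_V_and_limsup_le (hx : D.IsSolution I x₀ (Ici 0) x) (c : D.Comparison) :
    IsBoundedUnder (· ≤ ·) atTop (fun t => D.V (x t).1) ∧
      limsup (fun t => D.V (x t).1) atTop ≤ D.ε :=
  isBoundedUnder_and_limsup_le (fun _ => D.assumptionA.V_prop.nonneg _)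
    fun _ hη => hx.eventually_V_le c hη

lemma isBoundedUnder_Φ_and_limsup_le (hx : D.IsSolution I x₀ (Ici 0) x) (c : D.Comparison) :
    IsBoundedUnder (· ≤ ·) atTop (fun t => D.Φ (x t).2.1) ∧
      limsup (fun t => D.Φ (x t).2.1) atTop
        ≤ c.asymptoticGain (D.ε + limsup (fun t => ‖I.δ t‖) essAtTop) :=
  isBoundedUnder_and_limsup_le (fun _ => D.assumptionA.Φ_prop.nonneg _)
    fun _ hη => (hx.eventually_Φ_le c).mono fun _ ht => ht.trans (le_add_of_nonneg_right hη.le)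

lemma tendsto_U_zero (hx : D.IsSolution I x₀ (Ici 0) x) (c : D.Comparison)
    (hχ : Tendsto (fun t => D.χ ‖I.d t‖ ‖I.δ t‖ ‖I.θ t‖ (Real.exp (x t).2.2)) essAtTop (𝓝 0)) :
    Tendsto (fun t => D.U (x t)) atTop (𝓝 0) := by
  rw [tendsto_order]
  refine ⟨fun K hK => .of_forall fun t => hK.trans_le (D.U_nonneg _), fun K hK => ?_⟩
  have hη : 0 < c.σ.symm (K / 2) :=
    (orderIso_symm_zero c.σ_zero).symm.trans_lt (c.σ.symm.strictMono (half_pos hK))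
  obtain ⟨T₀, hT₀, hsmall⟩ := eventually_essAtTop_iff.1 (hχ.eventually_le_const hη)
  have hev := HasDerivLEOn.eventually_le (l := K / 2)
    (fun T hT => (hx.restrict_Icc T).hasDerivLEOn_U hT) (fun t _ => D.U_nonneg _) hη hT₀
    (hsmall.mono fun s hs hsT hU => by
      have hσU := c.σ.symm.monotone hU.le
      exact (add_le_add_right (hs hsT) _).trans
        ((c.neg_rate_mul_add_le hσU).trans (neg_le_neg hσU)))
  filter_upwards [hev] with t ht using ht.trans_lt (half_lt_self hK)

lemma tendsto_χ_zero {zlim : ℝ} (hz : Tendsto (fun t => (x t).2.2) atTop (𝓝 zlim))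
    (hγ : D.γ 0 = 0) (hΛ : D.Λ = 0) (hd : Tendsto I.d essAtTop (𝓝 0))
    (hδ : Tendsto I.δ essAtTop (𝓝 0)) {θ₀ : Vec p}
    (hθ : ∀ᵐ t ∂(volume.restrict (Ici (0 : ℝ))), I.θ t = θ₀)
    (hle : ‖θ₀‖ - D.b ≤ Real.exp zlim) :
    Tendsto (fun t => D.χ ‖I.d t‖ ‖I.δ t‖ ‖I.θ t‖ (Real.exp (x t).2.2)) essAtTop (𝓝 0) := by
  rw [ae_restrict_iff' measurableSet_Ici] at hθ
  have hθ' : Tendsto (fun t => ‖I.θ t‖) essAtTop (𝓝 ‖θ₀‖) :=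
    tendsto_const_nhds.congr'
      ((eventually_essAtTop_of_ae hθ).mono fun t ht => congrArg norm ht.symm)
  have hlim := (D.continuous_χ.tendsto _).comp (hd.norm.prodMk_nhds
    (hδ.norm.prodMk_nhds (hθ'.prodMk_nhds (hz.mono_left inf_le_left))))
  simpa only [Function.comp_def, norm_zero, max_self, max_eq_left (norm_nonneg _),
    χ_eq_zero hγ hΛ hle] using hlim

lemma tendsto_norm_zero (h : Tendsto (fun t => D.U (x t)) atTop (𝓝 0)) :
    Tendsto (fun t => ‖(x t).1‖) atTop (𝓝 0) ∧ Tendsto (fun t => ‖(x t).2.1‖) atTop (𝓝 0) := by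
  have hΦ : Tendsto (fun t => 2 / D.r * D.U (x t)) atTop (𝓝 0) := by
    simpa only [mul_zero] using h.const_mul (2 / D.r)
  exact ⟨D.assumptionA.V_prop.tendsto_norm_zero (squeeze_zero
      (fun t => D.assumptionA.V_prop.nonneg _) (fun t => D.V_le_U _) h),
    D.assumptionA.Φ_prop.tendsto_norm_zero (squeeze_zero
      (fun t => D.assumptionA.Φ_prop.nonneg _) (fun t => D.Φ_le_U _) hΦ)⟩

lemma tendsto_norm_zero_or_gain_lt (hx : D.IsSolution I x₀ (Ici 0) x) (c : D.Comparison)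
    {zlim : ℝ} (hz : Tendsto (fun t => (x t).2.2) atTop (𝓝 zlim))
    (hγ : D.γ 0 = 0) (hΛ : D.Λ = 0) (hd : Tendsto I.d essAtTop (𝓝 0))
    (hδ : Tendsto I.δ essAtTop (𝓝 0)) {θ₀ : Vec p}
    (hθ : ∀ᵐ t ∂(volume.restrict (Ici (0 : ℝ))), I.θ t = θ₀) :
    (Tendsto (fun t => ‖(x t).1‖) atTop (𝓝 0) ∧ Tendsto (fun t => ‖(x t).2.1‖) atTop (𝓝 0)) ∨
      (D.b < ‖θ₀‖ ∧ zlim < Real.log (‖θ₀‖ - D.b)) := by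
  rcases le_or_gt (‖θ₀‖ - D.b) (Real.exp zlim) with hle | hlt
  · exact .inl (tendsto_norm_zero (hx.tendsto_U_zero c (tendsto_χ_zero hz hγ hΛ hd hδ hθ hle)))
  · have hpos : 0 < ‖θ₀‖ - D.b := (Real.exp_pos _).trans hlt
    exact .inr ⟨sub_pos.1 hpos, (Real.lt_log_iff_exp_lt hpos).2 hlt⟩

end IsSolution

end Design

end Asymptotics

end DADS

theorem theorem1 {n l m p q : ℕ} (S : DADS.Plant n l m p q)
    (V Q k : DADS.Vec n → ℝ) (Φ R : DADS.Vec l → ℝ) (μ : DADS.Vec n → ℝ)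
    (r Λ : ℝ) (γ : ℝ → ℝ) (hA : DADS.AssumptionA S V Q k Φ R μ r Λ γ)
    (ε Γ a β b C : ℝ) (hε : 0 < ε) (hΓ : 0 < Γ) (ha : 0 < a) (ha1 : a ≤ 1)
    (hβ : 0 < β) (hβ1 : β ≤ 1) (hb : 1 ≤ b) (hC : 1 ≤ C) (hab : 2 * a * β < b * r) :
    ∃ (om : ℝ → ℝ → ℝ) (ζ ζt : ℝ → ℝ)
      (B : (DADS.Vec n × DADS.Vec l × ℝ) × (ℝ × ℝ × ℝ) → ℝ),
      DADS.IsClassKL om ∧ DADS.IsClassKInfty ζ ∧ DADS.IsGainFunction ζt ∧ Continuous B ∧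
      (γ 0 = 0 → ζt 0 = 0) ∧
      ∀ (y₀ : DADS.Vec n) (w₀ : DADS.Vec l) (z₀ : ℝ)
        (d : ℝ → DADS.Vec m) (θ : ℝ → DADS.Vec p) (δ : ℝ → DADS.Vec q),
        DADS.IsLInfty d → DADS.IsLInfty θ → DADS.IsLInfty δ →
        ∃ (y : ℝ → DADS.Vec n) (w : ℝ → DADS.Vec l) (z : ℝ → ℝ),
          -- `(y, w, z)` is a solution defined for all `t ≥ 0`
          DADS.IsCaratheodorySolution (DADS.closedLoop S V k μ ε Γ a β b C d θ δ)
            (y₀, w₀, z₀) (Ici 0) (fun t => (y t, w t, z t)) ∧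
          -- every solution on an interval `[0, T)` coincides with it there
          (∀ (T : ℝ) (x : ℝ → DADS.Vec n × DADS.Vec l × ℝ), 0 < T →
            DADS.IsCaratheodorySolution (DADS.closedLoop S V k μ ε Γ a β b C d θ δ)
              (y₀, w₀, z₀) (Ico 0 T) x →
            EqOn x (fun t => (y t, w t, z t)) (Ico 0 T)) ∧
          -- asymptotic estimate for the measured state
          (IsBoundedUnder (· ≤ ·) atTop (fun t => V (y t)) ∧
            limsup (fun t => V (y t)) atTop ≤ ε) ∧
          -- asymptotic estimate for the unmeasured state
          (IsBoundedUnder (· ≤ ·) atTop (fun t => Φ (w t)) ∧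
            limsup (fun t => Φ (w t)) atTop
              ≤ ζt (ε + limsup (fun t => ‖δ t‖) DADS.essAtTop)) ∧
          -- practical input-to-output stability estimate
          (∀ t, 0 ≤ t → DADS.lyapU V Φ r (y t) (w t)
              ≤ om (DADS.lyapU V Φ r y₀ w₀) t
                + ζ (DADS.chi γ r Λ a β b (DADS.supNorm d) (DADS.supNorm δ)
                    (DADS.supNorm θ) (Real.exp z₀))) ∧
          MonotoneOn z (Ici 0) ∧
          ∃ zlim : ℝ, Tendsto z atTop (𝓝 zlim) ∧
            -- bounds for the dynamic gain
            (∀ t, 0 ≤ t → z₀ ≤ z t ∧ z t ≤ zlim) ∧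
            zlim ≤ B ((y₀, w₀, z₀),
              (DADS.supNorm d, DADS.supNorm δ, DADS.supNorm θ)) ∧
            -- the vanishing case
            (γ 0 = 0 → Λ = 0 → Tendsto d DADS.essAtTop (𝓝 0) →
              Tendsto δ DADS.essAtTop (𝓝 0) →
              ∀ θ₀ : DADS.Vec p, (∀ᵐ t ∂(volume.restrict (Ici (0 : ℝ))), θ t = θ₀) →
                (Tendsto (fun t => ‖y t‖) atTop (𝓝 0) ∧
                  Tendsto (fun t => ‖w t‖) atTop (𝓝 0)) ∨
                (b < ‖θ₀‖ ∧ zlim < Real.log (‖θ₀‖ - b))) := by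
  let D : DADS.Design n l m p q := ⟨S, V, Q, k, Φ, R, μ, r, Λ, γ, ε, Γ, a, β, b, C, hA, hε, hΓ,
    ha, ha1, hβ, hβ1, hb, hC, hab⟩
  obtain ⟨c⟩ := D.nonempty_comparison
  refine ⟨DADS.decayKL c.σ.symm, c.σ, c.asymptoticGain, c.gainLimitBound,
    DADS.isClassKL_decayKL (DADS.orderIso_symm_zero c.σ_zero),
    DADS.isClassKInfty_orderIso c.σ_zero, c.isGainFunction_asymptoticGain,
    c.continuous_gainLimitBound, c.asymptoticGain_zero, fun y₀ w₀ z₀ d θ δ hd hθ hδ => ?_⟩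
  let I : DADS.Inputs m p q := ⟨d, θ, δ, hd, hθ, hδ⟩
  obtain ⟨x, hx⟩ := DADS.Design.exists_isSolution c I (y₀, w₀, z₀)
  obtain ⟨zlim, hzB, hz, hzle⟩ := hx.exists_tendsto_gain c
  refine ⟨fun t => (x t).1, fun t => (x t).2.1, fun t => (x t).2.2, hx, ?unique, ?limsup_V,
    ?limsup_Φ, ?stability, hx.monotoneOn_gain_Ici, zlim, hz, ?gain, hzB, ?vanishing⟩
  case unique => exact fun T x' _ hx' => DADS.Design.IsSolution.eqOn_Ico hx' hx
  case limsup_V => exact hx.isBoundedUnder_V_and_limsup_le c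
  case limsup_Φ => exact hx.isBoundedUnder_Φ_and_limsup_le c
  case stability => exact fun t ht => (hx.restrict_Icc t).U_le c ht
  case gain => exact fun t ht => ⟨(hx.restrict_Icc t).le_gain ⟨ht, le_rfl⟩, hzle t ht⟩
  case vanishing =>
    exact fun hγ hΛ hd0 hδ0 θ₀ hθ₀ => hx.tendsto_norm_zero_or_gain_lt c hz hγ hΛ hd0 hδ0 hθ₀
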